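/- Let $\Omega\subset\mathbb R^n$ be a bounded open set (for instance a bounded Lipschitz domain). Let $\gamma,\beta\in C^1(\overline\Omega)$ with $\gamma\ge 1$ and $\beta\ge 1$ on $\Omega$, and let $\theta:\Omega\to[1,\infty)$ be measurable and essentially bounded with $\theta(x)\ge\gamma(x)+\beta(x)+\varepsilon_0$ for a.e. $x\in\Omega$, for some constant $\varepsilon_0>0$. Functions that are equal almost everywhere are identified. For a bounded measurable exponent $p\ge 1$ let $L^{p(x)}(\Omega)$ be the set of measurable $u:\Omega\to\mathbb R$ with $\int_\Omega|u|^{p(x)}\,dx<\infty$. Let $$L^{1,\beta(x)}(\Omega)=\{v\in L^1(\Omega): D_iv\in L^{\beta(x)}(\Omega),\ i=1,\dots,n\},$$ where $D_i v$ is the weak derivative, and let $$S_{1,\gamma,\beta,\theta}(\Omega)=\Big\{u\in L^1(\Omega)\cap L^{\theta(x)}(\Omega):\int_\Omega|u|^{\gamma(x)+\beta(x)}dx+\sum_{i=1}^n\int_\Omega|u|^{\gamma(x)}|D_iu|^{\beta(x)}dx<\infty\Big\}.$$ In the last formula $D_iu$ is only needed on $\{u\neq0\}$, and it is understood there as follows: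 it is a measurable function such that, for every $\varepsilon>0$, the truncation $u-\max(-\varepsilon,\min(\varepsilon,u))$ has the locally integrable weak derivative $\mathbf 1_{\{|u|>\varepsilon\}}D_iu$ in $\Omega$. (It is unique a.e. on $\{u\ne0\}$, and if $u$ has a locally integrable weak derivative, it coincides with it there.) Then $\varphi(u)(x)=|u(x)|^{\gamma(x)/\beta(x)}u(x)$ defines a bijection from $S_{1,\gamma,\beta,\theta}(\Omega)$ onto $L^{1,\beta(x)}(\Omega)\cap L^{\psi(x)}(\Omega)$, where $\psi(x)=\dfrac{\theta(x)\beta(x)}{\gamma(x)+\beta(x)}$. -/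

import Mathlib

open MeasureTheory Set
open scoped ContDiff

/-- Euclidean `n`-space. -/
abbrev Eucl (n : ℕ) : Type := EuclideanSpace ℝ (Fin n)

/-- Measurable real functions on `Ω`, up to equality almost everywhere (Lebesgue measure). -/
abbrev FunOn {n : ℕ} (Ω : Set (Eucl n)) : Type :=
  Eucl n →ₘ[(volume : Measure (Eucl n)).restrict Ω] ℝ

/-- `p ∈ C¹(Ω̄)`: `p` is continuous on `Ω̄`, differentiable in `Ω`, and its derivative is the
restriction to `Ω` of a continuous function on `Ω̄`. -/
def IsC1Closure {n : ℕ} (Ω : Set (Eucl n)) (p : Eucl n → ℝ) : Prop :=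
  ContinuousOn p (closure Ω) ∧
    ∃ p' : Eucl n → (Eucl n →L[ℝ] ℝ), ContinuousOn p' (closure Ω) ∧
      ∀ x ∈ Ω, HasFDerivAt p (p' x) x

/-- The exponent class `M₀(Ω)`: measurable functions `p` on `Ω` with
`1 ≤ p(x) ≤ p⁺ < ∞` for almost every `x ∈ Ω`. -/
def IsBddExponent {n : ℕ} (Ω : Set (Eucl n)) (p : Eucl n → ℝ) : Prop :=
  AEMeasurable p ((volume : Measure (Eucl n)).restrict Ω) ∧
    ∃ C : ℝ, ∀ᵐ x ∂((volume : Measure (Eucl n)).restrict Ω), 1 ≤ p x ∧ p x ≤ C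

/-- The modular `σ_p(u) = ∫_Ω |u|^{p(x)} dx`, with values in `[0, ∞]`. -/
noncomputable def varModular {n : ℕ} (Ω : Set (Eucl n)) (p u : Eucl n → ℝ) : ENNReal :=
  ∫⁻ x in Ω, ENNReal.ofReal (|u x| ^ p x)

/-- `D_i u = g` on the open set `Ω` in the usual weak sense: `u` and `g` are locally integrable
on `Ω` and `∫_Ω u ∂_i η = - ∫_Ω g η` for all test functions `η ∈ C_c^∞(Ω)`. -/
def HasWeakPartial {n : ℕ} (Ω : Set (Eucl n)) (i : Fin n) (u g : Eucl n → ℝ) : Prop :=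
  LocallyIntegrableOn u Ω ∧ LocallyIntegrableOn g Ω ∧
    ∀ η : Eucl n → ℝ, ContDiff ℝ ∞ η → HasCompactSupport η → tsupport η ⊆ Ω →
      ∫ x in Ω, u x * fderiv ℝ η x (EuclideanSpace.single i 1) = - ∫ x in Ω, g x * η x

/-- The truncation `t ↦ t - max (-ε) (min ε t)`: it vanishes for `|t| ≤ ε` and equals
`t - ε sign t` for `|t| ≥ ε`. -/
def cutNearZero (ε t : ℝ) : ℝ := t - max (-ε) (min ε t)

/-- `D_i u = g` on `{u ≠ 0}`, the only place where the degenerate expression `|u|^γ |D_i u|^β`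
sees the derivative: for every `ε > 0` the truncation of `u` that removes the values `|u| ≤ ε`
has the weak derivative `g` times the indicator function of `{|u| > ε}`. This determines `g`
almost everywhere on `{u ≠ 0}`, and there it is the weak derivative of `u` whenever `u` has a
locally integrable weak derivative. -/
def HasWeakPartialOffZero {n : ℕ} (Ω : Set (Eucl n)) (i : Fin n) (u g : Eucl n → ℝ) : Prop :=
  AEStronglyMeasurable g ((volume : Measure (Eucl n)).restrict Ω) ∧
    ∀ ε : ℝ, 0 < ε →
      HasWeakPartial Ω i (fun x => cutNearZero ε (u x)) ({x | ε < |u x|}.indicator g)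

/-- The variable exponent Lebesgue space `L^{p(x)}(Ω)` for a bounded exponent `p`. -/
def LVar {n : ℕ} (Ω : Set (Eucl n)) (p : Eucl n → ℝ) : Set (FunOn Ω) :=
  {u | varModular Ω p u < ⊤}

/-- `L^{1,β(x)}(Ω)`: the `u ∈ L¹(Ω)` all of whose weak derivatives `D_i u` lie in
`L^{β(x)}(Ω)`. -/
def L1Var {n : ℕ} (Ω : Set (Eucl n)) (β : Eucl n → ℝ) : Set (FunOn Ω) :=
  {u | Integrable u ((volume : Measure (Eucl n)).restrict Ω) ∧
    ∀ i : Fin n, ∃ g : Eucl n → ℝ, HasWeakPartial Ω i u g ∧ varModular Ω β g < ⊤}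

/-- `S_{1,γ(x),β(x)}(Ω)`: the `u ∈ L¹(Ω)` with
`∫_Ω |u|^{γ+β} dx + ∑_i ∫_Ω |u|^γ |D_i u|^β dx < ∞`. -/
def S1 {n : ℕ} (Ω : Set (Eucl n)) (γ β : Eucl n → ℝ) : Set (FunOn Ω) :=
  {u | Integrable u ((volume : Measure (Eucl n)).restrict Ω) ∧
    ∃ Du : Fin n → Eucl n → ℝ, (∀ i, HasWeakPartialOffZero Ω i u (Du i)) ∧
      varModular Ω (fun x => γ x + β x) u +
        ∑ i, ∫⁻ x in Ω, ENNReal.ofReal (|u x| ^ γ x * |Du i x| ^ β x) < ⊤}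

/-- `S_{1,γ(x),β(x),θ(x)}(Ω) = S_{1,γ(x),β(x)}(Ω) ∩ L^{θ(x)}(Ω)`. -/
def S1Theta {n : ℕ} (Ω : Set (Eucl n)) (γ β θ : Eucl n → ℝ) : Set (FunOn Ω) :=
  S1 Ω γ β ∩ LVar Ω θ

open Filter Topology
open scoped Convolution

/-! Put a = γ/β and b = -γ/(γ+β). The map t ↦ |t|^a t keeps the sign and raises |t| to the power a +
1. Since (a+1)(b+1) = 1, t ↦ |t|^b t is its pointwise inverse. Injectivity is then immediate, and
the content lies in the two inclusions.

If v = φ(u), then |v|^ψ = |u|^θ, so the Lebesgue conditions correspond. Formally, D_i v = |u|^a u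
log|u| D_i a + (1+a)|u|^a D_i u. The β-th power of the second term is a bounded multiple of |u|^γ
|D_i u|^β. The first term is the price of a variable exponent: since (a+1)β = γ+β, its β-th power is
of size |u|^(γ+β) times a power of the logarithm. A logarithm costs an arbitrarily small extra
power, which fits into the gap ε₀ between γ+β and θ (`rpow_mul_abs_log_mul_rpow_le`). In the other
direction |u|^γ |D_i u|^β = (|v|^(-b) |D_i u|)^β; the weight cancels the singular factor |v|^b in
D_i u, and the logarithmic term is controlled because ψ ≥ (1+κ)β for some κ > 0.

Most of the work is the chain rule itself. It is proved by mollification for bounded C¹ functions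
(`HasWeakPartial.comp_bounded`). Powers are reached by bounding large values with an arctangent,
replacing |c|^a c by c(c²+δ²)^(a/2), and passing to the limit by domination
(`HasWeakPartial.of_tendsto`). For a > 0 the function u is cut near zero beforehand
(`HasWeakPartialOffZero.abs_rpow_mul`). For the negative exponent b the result is cut afterwards,
which is why only a derivative off zero is obtained (`HasWeakPartial.abs_rpow_mul_offZero`). -/

/-! ### Cutoffs and integrals against test functions -/

theorem exists_cutoff {n : ℕ} {Ω K : Set (Eucl n)} (hΩ : IsOpen Ω) (hK : IsCompact K)
    (hKΩ : K ⊆ Ω) :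
    ∃ χ : Eucl n → ℝ, ContDiff ℝ ∞ χ ∧ HasCompactSupport χ ∧ tsupport χ ⊆ Ω ∧
      ∀ x ∈ K, χ =ᶠ[𝓝 x] fun _ => 1 := by
  obtain ⟨L, hL, hKL, hLΩ⟩ := exists_compact_between hK hΩ hKΩ
  obtain ⟨f, hf1, hf0, -⟩ := exists_contMDiffMap_one_nhds_of_subset_interior
    (n := ⊤) (modelWithCornersSelf ℝ (Eucl n)) hK.isClosed hKL
  have hsupp : tsupport f ⊆ L := by
    refine closure_minimal (fun x hx => ?_) hL.isClosed
    by_contra h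
    exact hx (hf0 x h)
  refine ⟨f, f.contMDiff.contDiff, hL.of_isClosed_subset (isClosed_tsupport _) hsupp,
    hsupp.trans hLΩ, fun x hx => ?_⟩
  exact (eventually_nhdsSet_iff_forall.1 hf1) x hx

theorem MeasureTheory.LocallyIntegrableOn.integrable_mul_of_tsupport_subset {n : ℕ} {Ω : Set (Eucl n)}
    {w η : Eucl n → ℝ} (hw : LocallyIntegrableOn w Ω) (hη : Continuous η)
    (hηc : HasCompactSupport η) (hηΩ : tsupport η ⊆ Ω) :
    Integrable (fun x => w x * η x) := by
  have h1 : IntegrableOn w (tsupport η) := hw.integrableOn_compact_subset hηΩ hηc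
  have h2 := h1.mul_continuousOn hη.continuousOn hηc
  refine (integrableOn_iff_integrable_of_support_subset (fun x hx => ?_)).1 h2
  refine subset_tsupport η (fun h0 => hx ?_)
  simp [h0]

theorem setIntegral_eq_integral_of_tsupport_subset {n : ℕ} {Ω : Set (Eucl n)}
    {w η : Eucl n → ℝ} (hηΩ : tsupport η ⊆ Ω) :
    ∫ x in Ω, w x * η x = ∫ x, w x * η x := by
  refine setIntegral_eq_integral_of_forall_compl_eq_zero (fun x hx => ?_)
  rw [image_eq_zero_of_notMem_tsupport (fun h => hx (hηΩ h)), mul_zero]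

theorem ContDiff.continuous_fderiv_apply_const {n : ℕ} {η : Eucl n → ℝ} (hη : ContDiff ℝ ∞ η)
    (v : Eucl n) : Continuous fun x => fderiv ℝ η x v :=
  (hη.continuous_fderiv (by simp)).clm_apply continuous_const

theorem HasCompactSupport.fderiv_apply_const {n : ℕ} {η : Eucl n → ℝ} (hη : HasCompactSupport η)
    (v : Eucl n) : HasCompactSupport fun x => fderiv ℝ η x v :=
  (hη.fderiv (𝕜 := ℝ)).mono' (fun x hx => subset_tsupport _ (fun h => hx (by simp [h])))

theorem tsupport_fderiv_apply_const_subset {n : ℕ} (η : Eucl n → ℝ)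
    (v : Eucl n) : tsupport (fun x => fderiv ℝ η x v) ⊆ tsupport η :=
  (closure_mono (fun x hx => by
    show x ∈ Function.support (fderiv ℝ η)
    exact fun h => hx (by simp [h]))).trans (tsupport_fderiv_subset ℝ)

/-! ### Mollification and L¹ convergence -/

/-- A version of Scheffé's lemma. -/
theorem tendsto_integral_abs_sub_of_nonneg {α : Type*} [MeasurableSpace α] {μ : Measure α}
    {f : ℕ → α → ℝ} {g : α → ℝ} (hf : ∀ k, Integrable (f k) μ) (hg : Integrable g μ)
    (hf0 : ∀ k x, 0 ≤ f k x) (hg0 : ∀ x, 0 ≤ g x)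
    (hfg : ∀ᵐ x ∂μ, Tendsto (fun k => f k x) atTop (𝓝 (g x)))
    (hint : ∀ k, ∫ x, f k x ∂μ = ∫ x, g x ∂μ) :
    Tendsto (fun k => ∫ x, |f k x - g x| ∂μ) atTop (𝓝 0) := by
  have h1 : Tendsto (fun k => ∫ x, max (g x - f k x) 0 ∂μ) atTop (𝓝 (∫ _, (0 : ℝ) ∂μ)) := by
    refine tendsto_integral_of_dominated_convergence g
      (fun k => ((hg.sub (hf k)).pos_part).aestronglyMeasurable) hg
      (fun k => Eventually.of_forall fun x => ?_) ?_
    · rw [Real.norm_eq_abs, abs_of_nonneg (le_max_right _ _)]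
      exact max_le (by linarith [hf0 k x]) (hg0 x)
    · filter_upwards [hfg] with x hx
      have : Tendsto (fun k => max (g x - f k x) 0) atTop (𝓝 (max (g x - g x) 0)) :=
        (tendsto_const_nhds.sub hx).max tendsto_const_nhds
      simpa using this
  -- Since |f - g| = 2(g - f)⁺ - (g - f) and f, g have equal integrals, only the positive part
  -- remains; it is dominated by g because f ≥ 0.
  have h2 : ∀ k, ∫ x, |f k x - g x| ∂μ = 2 * ∫ x, max (g x - f k x) 0 ∂μ := by
    intro k
    have h3 : ∀ x, |f k x - g x| = 2 * max (g x - f k x) 0 - (g x - f k x) := by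
      intro x
      rcases le_total (g x) (f k x) with h | h
      · rw [abs_of_nonneg (by linarith), max_eq_right (by linarith)]; ring
      · rw [abs_of_nonpos (by linarith), max_eq_left (by linarith)]; ring
    simp_rw [h3]
    have hi : Integrable (fun x => max (g x - f k x) 0) μ := (hg.sub (hf k)).pos_part
    have hi' : Integrable (fun x => g x - f k x) μ := hg.sub (hf k)
    rw [integral_sub (hi.const_mul 2) hi', integral_sub hg (hf k), hint k, integral_const_mul]
    simp
  simp_rw [h2]
  simpa using h1.const_mul 2

section mollify

variable {n : ℕ}

/-- The bounded ratio of the radii is what almost everywhere convergence at Lebesgue points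
requires. -/
theorem exists_contDiffBump_seq (n : ℕ) : ∃ φ : ℕ → ContDiffBump (0 : Eucl n),
    Tendsto (fun k => (φ k).rOut) atTop (𝓝 0) ∧ ∀ k, (φ k).rOut ≤ 2 * (φ k).rIn := by
  refine ⟨fun k => ⟨1 / ((k : ℝ) + 1) / 2, 1 / ((k : ℝ) + 1), by positivity,
    half_lt_self (by positivity)⟩, tendsto_one_div_add_atTop_nhds_zero_nat, fun k => ?_⟩
  show 1 / ((k : ℝ) + 1) ≤ 2 * (1 / ((k : ℝ) + 1) / 2)
  linarith

theorem integrable_mollify (φ : ContDiffBump (0 : Eucl n)) {g : Eucl n → ℝ}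
    (hg : Integrable g) :
    Integrable (φ.normed volume ⋆[ContinuousLinearMap.lsmul ℝ ℝ, volume] g) :=
  (φ.integrable_normed (μ := volume)).integrable_convolution _ hg

/-- Mollification preserves nonnegativity and the total integral, so Scheffé's lemma upgrades
convergence at Lebesgue points to convergence in L¹. -/
theorem tendsto_integral_abs_mollify_sub_of_nonneg {φ : ℕ → ContDiffBump (0 : Eucl n)}
    (hφ : Tendsto (fun k => (φ k).rOut) atTop (𝓝 0)) (hφ2 : ∀ k, (φ k).rOut ≤ 2 * (φ k).rIn)
    {g : Eucl n → ℝ} (hg : Integrable g) (hg0 : ∀ x, 0 ≤ g x) :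
    Tendsto (fun k => ∫ x, |((φ k).normed volume ⋆[ContinuousLinearMap.lsmul ℝ ℝ, volume] g) x
      - g x|) atTop (𝓝 0) := by
  refine tendsto_integral_abs_sub_of_nonneg (fun k => integrable_mollify _ hg) hg
    (fun k x => ?_) hg0
    (ContDiffBump.ae_convolution_tendsto_right_of_locallyIntegrable (K := 2) hφ
      (Eventually.of_forall hφ2) hg.locallyIntegrable) (fun k => ?_)
  · rw [convolution_def]
    exact integral_nonneg fun t => mul_nonneg ((φ k).nonneg_normed t) (hg0 _)
  · rw [integral_convolution _ ((φ k).integrable_normed (μ := volume)) hg,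
      (φ k).integral_normed]
    simp

theorem tendsto_integral_abs_mollify_sub {φ : ℕ → ContDiffBump (0 : Eucl n)}
    (hφ : Tendsto (fun k => (φ k).rOut) atTop (𝓝 0)) (hφ2 : ∀ k, (φ k).rOut ≤ 2 * (φ k).rIn)
    {g : Eucl n → ℝ} (hg : Integrable g) :
    Tendsto (fun k => ∫ x, |((φ k).normed volume ⋆[ContinuousLinearMap.lsmul ℝ ℝ, volume] g) x
      - g x|) atTop (𝓝 0) := by
  have hp := hg.pos_part
  have hn := hg.neg_part
  have h1 := tendsto_integral_abs_mollify_sub_of_nonneg hφ hφ2 hp (fun x => le_max_right _ _)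
  have h2 := tendsto_integral_abs_mollify_sub_of_nonneg hφ hφ2 hn (fun x => le_max_right _ _)
  have h3 := h1.add h2
  rw [add_zero] at h3
  refine squeeze_zero (fun k => integral_nonneg fun x => abs_nonneg _) (fun k => ?_) h3
  have i1 := ((integrable_mollify (φ k) hp).sub hp).abs
  have i2 := ((integrable_mollify (φ k) hn).sub hn).abs
  have i0 := ((integrable_mollify (φ k) hg).sub hg).abs
  have := integral_add i1 i2
  refine le_trans (integral_mono i0 (i1.add i2) (fun x => ?_)) this.le
  have hex : ∀ f : Eucl n → ℝ, Integrable f → ConvolutionExistsAt ((φ k).normed volume) f x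
      (ContinuousLinearMap.lsmul ℝ ℝ) volume := fun f hf =>
    ((φ k).hasCompactSupport_normed).convolutionExists_left _ (φ k).continuous_normed
      hf.locallyIntegrable x
  have hsplit : g = (fun x => max (g x) 0) + (-1 : ℝ) • (fun x => max (-g x) 0) := by
    funext y
    simp only [Pi.add_apply, Pi.smul_apply, smul_eq_mul]
    rcases le_total (g y) 0 with h | h
    · rw [max_eq_right h, max_eq_left (by linarith)]; ring
    · rw [max_eq_left h, max_eq_right (by linarith)]; ring
  have hc : ((φ k).normed volume ⋆[ContinuousLinearMap.lsmul ℝ ℝ, volume] g) x =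
      ((φ k).normed volume ⋆[ContinuousLinearMap.lsmul ℝ ℝ, volume] (fun x => max (g x) 0)) x
      - ((φ k).normed volume ⋆[ContinuousLinearMap.lsmul ℝ ℝ, volume] fun x => max (-g x) 0) x := by
    conv_lhs => rw [hsplit]
    rw [(hex _ hp).distrib_add (hex _ (hn.smul (-1 : ℝ))), convolution_smul]
    simp [sub_eq_add_neg]
  have hgx : g x = max (g x) 0 - max (-g x) 0 := by
    have := congrFun hsplit x
    simp only [Pi.add_apply, Pi.smul_apply, smul_eq_mul] at this
    linarith
  simp only [Pi.sub_apply, Pi.add_apply]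
  rw [hc]
  conv_lhs => rw [hgx]
  refine le_trans (le_of_eq ?_) (abs_sub _ _)
  congr 1
  ring

/-- The derivative of the convolution falls on the kernel. The reflected kernel y ↦ ρ(x - y) is a
test function, and the sign from the reflection cancels the one from integration by parts. -/
theorem hasLineDerivAt_mollify (φ : ContDiffBump (0 : Eucl n)) {w g : Eucl n → ℝ} {v : Eucl n}
    (hw : Integrable w)
    (hwg : ∀ η : Eucl n → ℝ, ContDiff ℝ ∞ η → HasCompactSupport η →
      ∫ x, w x * fderiv ℝ η x v = - ∫ x, g x * η x) (x : Eucl n) :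
    HasLineDerivAt ℝ (φ.normed volume ⋆[ContinuousLinearMap.lsmul ℝ ℝ, volume] w)
      ((φ.normed volume ⋆[ContinuousLinearMap.lsmul ℝ ℝ, volume] g) x) x v := by
  have hd : HasFDerivAt (φ.normed volume ⋆[ContinuousLinearMap.lsmul ℝ ℝ, volume] w) _ x :=
    (φ.hasCompactSupport_normed (μ := volume)).hasFDerivAt_convolution_left
    (ContinuousLinearMap.lsmul ℝ ℝ) (φ.contDiff_normed (n := 1)) hw.locallyIntegrable x
  have hl := hd.hasLineDerivAt v
  set ρ := φ.normed (volume : Measure (Eucl n)) with hρ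
  have hρs : ContDiff ℝ ∞ ρ := φ.contDiff_normed
  have hρc : HasCompactSupport ρ := φ.hasCompactSupport_normed
  have hη : ContDiff ℝ ∞ fun y => ρ (x - y) := hρs.comp (contDiff_const.sub contDiff_id)
  have hηc : HasCompactSupport fun y => ρ (x - y) :=
    hρc.comp_homeomorph (Homeomorph.subLeft x)
  have hex : ConvolutionExistsAt (fderiv ℝ ρ) w x
      ((ContinuousLinearMap.lsmul ℝ ℝ : ℝ →L[ℝ] ℝ →L[ℝ] ℝ).precompL (Eucl n)) volume :=
    (hρc.fderiv (𝕜 := ℝ)).convolutionExists_left _ (hρs.continuous_fderiv (by simp))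
      hw.locallyIntegrable x
  have key := hwg _ hη hηc
  have hfd : ∀ y, fderiv ℝ (fun y => ρ (x - y)) y v = - fderiv ℝ ρ (x - y) v := by
    intro y
    have h1 : HasFDerivAt ρ (fderiv ℝ ρ (x - y)) (x - y) :=
      (hρs.differentiable (by simp)).differentiableAt.hasFDerivAt
    have h2 : HasFDerivAt (fun y => x - y) (-ContinuousLinearMap.id ℝ (Eucl n)) y :=
      (hasFDerivAt_id y).const_sub x
    have h3 : HasFDerivAt (fun y => ρ (x - y)) _ y := h1.comp y h2
    rw [h3.fderiv]
    simp
  suffices h : (ρ ⋆[ContinuousLinearMap.lsmul ℝ ℝ, volume] g) x = _ by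
    rw [h]
    exact hl
  rw [convolution_eq_swap, convolution_eq_swap]
  rw [ContinuousLinearMap.integral_apply hex.integrable_swap]
  simp only [ContinuousLinearMap.precompL_apply, ContinuousLinearMap.lsmul_apply, smul_eq_mul]
  simp only [hfd, mul_neg, integral_neg, neg_inj] at key
  simp only [mul_comm (fderiv ℝ ρ _ _), mul_comm (ρ _)]
  exact key.symm

end mollify

theorem ContinuousOn.continuous_mul_of_tsupport_subset {n : ℕ} {Ω : Set (Eucl n)} (hΩ : IsOpen Ω)
    {f η : Eucl n → ℝ} (hf : ContinuousOn f Ω) (hη : Continuous η) (hηΩ : tsupport η ⊆ Ω) :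
    Continuous fun x => f x * η x := by
  refine ContinuousOn.continuous_of_tsupport_subset (s := Ω) (hf.mul hη.continuousOn) hΩ ?_
  refine (closure_mono ?_).trans hηΩ
  exact fun x hx h0 => hx (by simp [h0])

/-- The two modes of convergence suit the chain rule: `W k` enters nonlinearly but inside bounded
functions, so convergence almost everywhere suffices; `G k` enters linearly against bounded factors,
so L¹ convergence suffices. -/
theorem exists_mollified_seq {n : ℕ} {w g : Eucl n → ℝ} {v : Eucl n}
    (hw : Integrable w) (hg : Integrable g)
    (hwg : ∀ η : Eucl n → ℝ, ContDiff ℝ ∞ η → HasCompactSupport η →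
      ∫ x, w x * fderiv ℝ η x v = - ∫ x, g x * η x) :
    ∃ W G : ℕ → Eucl n → ℝ, (∀ k, Continuous (W k)) ∧ (∀ k, Continuous (G k)) ∧
      (∀ k, Integrable (G k)) ∧ (∀ k x, HasLineDerivAt ℝ (W k) (G k x) x v) ∧
      (∀ᵐ x, Tendsto (fun k => W k x) atTop (𝓝 (w x))) ∧
      Tendsto (fun k => ∫ x, |G k x - g x|) atTop (𝓝 0) := by
  obtain ⟨φ, hφ, hφ2⟩ := exists_contDiffBump_seq n
  refine ⟨fun k => (φ k).normed volume ⋆[ContinuousLinearMap.lsmul ℝ ℝ, volume] w,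
    fun k => (φ k).normed volume ⋆[ContinuousLinearMap.lsmul ℝ ℝ, volume] g,
    fun k => ?_, fun k => ?_, fun k => integrable_mollify _ hg,
    fun k => hasLineDerivAt_mollify (φ k) hw hwg,
    ContDiffBump.ae_convolution_tendsto_right_of_locallyIntegrable (K := 2) hφ
      (Eventually.of_forall hφ2) hw.locallyIntegrable,
    tendsto_integral_abs_mollify_sub hφ hφ2 hg⟩
  · exact ((φ k).hasCompactSupport_normed (μ := volume)).continuous_convolution_left _
      (φ k).continuous_normed hw.locallyIntegrable
  · exact ((φ k).hasCompactSupport_normed (μ := volume)).continuous_convolution_left _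
      (φ k).continuous_normed hg.locallyIntegrable

/-! ### The chain rule for bounded functions and limits of weak derivatives -/

/-- Multiplication by a cutoff turns a weak derivative in `Ω` into one in the whole space. -/
theorem HasWeakPartial.mul_cutoff {n : ℕ} {Ω : Set (Eucl n)} {i : Fin n} {w g χ : Eucl n → ℝ}
    (h : HasWeakPartial Ω i w g) (hχ : ContDiff ℝ ∞ χ) (hχc : HasCompactSupport χ)
    (hχΩ : tsupport χ ⊆ Ω) {η : Eucl n → ℝ} (hη : ContDiff ℝ ∞ η) :
      ∫ x, (w x * χ x) * fderiv ℝ η x (EuclideanSpace.single i 1) =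
      - ∫ x, (g x * χ x + w x * fderiv ℝ χ x (EuclideanSpace.single i 1)) * η x := by
  obtain ⟨hw, hg, hwg⟩ := h
  set v : Eucl n := EuclideanSpace.single i 1
  have hmul : ∀ f f' : Eucl n → ℝ, tsupport (fun x => f x * f' x) ⊆ tsupport f := fun f f' =>
    closure_mono fun x hx h0 => hx (by simp [h0])
  have hsub := hmul χ η
  have key := hwg (fun x => χ x * η x) (hχ.mul hη) (hχc.mul_right) (hsub.trans hχΩ)
  rw [setIntegral_eq_integral_of_tsupport_subset (hsub.trans hχΩ),
    setIntegral_eq_integral_of_tsupport_subset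
      ((tsupport_fderiv_apply_const_subset _ v).trans (hsub.trans hχΩ))] at key
  have hfd : ∀ x, fderiv ℝ (fun x => χ x * η x) x v =
      χ x * fderiv ℝ η x v + fderiv ℝ χ x v * η x := by
    intro x
    rw [fderiv_fun_mul (hχ.differentiable (by simp)).differentiableAt
      (hη.differentiable (by simp)).differentiableAt]
    simp [mul_comm]
  have c1 := hχ.continuous
  have c2 := hη.continuous
  have c3 := hχ.continuous_fderiv_apply_const v
  have c4 := hη.continuous_fderiv_apply_const v
  have i1 : Integrable fun x => w x * (χ x * fderiv ℝ η x v) :=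
    hw.integrable_mul_of_tsupport_subset (c1.mul c4) hχc.mul_right
      ((hmul _ _).trans hχΩ)
  have i2 : Integrable fun x => w x * (fderiv ℝ χ x v * η x) :=
    hw.integrable_mul_of_tsupport_subset (c3.mul c2) (hχc.fderiv_apply_const v).mul_right
      (((hmul _ _).trans
        (tsupport_fderiv_apply_const_subset χ v)).trans hχΩ)
  have i3 : Integrable fun x => g x * (χ x * η x) :=
    hg.integrable_mul_of_tsupport_subset (c1.mul c2) hχc.mul_right (hsub.trans hχΩ)
  simp only [hfd, mul_add] at key
  rw [integral_add i1 i2] at key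
  simp only [add_mul, mul_assoc]
  rw [integral_add i3 i2]
  linarith

/-- Chain rule for weak derivatives: `R (a x) (w x)`, where `R` is `C¹`, bounded with bounded
derivatives, and `a` is `C¹`. -/
theorem HasWeakPartial.comp_bounded {n : ℕ} {Ω : Set (Eucl n)} (hΩ : IsOpen Ω) {i : Fin n}
    {w g a : Eucl n → ℝ} {a' : Eucl n → (Eucl n →L[ℝ] ℝ)} {A C : ℝ}
    (h : HasWeakPartial Ω i w g)
    (ha : ∀ x ∈ Ω, HasFDerivAt a (a' x) x) (ha' : ContinuousOn a' Ω)
    (haA : ∀ x ∈ Ω, |a x| ≤ A)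
    {R R₁ R₂ : ℝ → ℝ → ℝ} (hR : Continuous (Function.uncurry R))
    (hR₁ : Continuous (Function.uncurry R₁)) (hR₂ : Continuous (Function.uncurry R₂))
    (hder : ∀ (p q : ℝ → ℝ) (p' q' s : ℝ), HasDerivAt p p' s → HasDerivAt q q' s →
      HasDerivAt (fun s => R (p s) (q s)) (R₁ (p s) (q s) * p' + R₂ (p s) (q s) * q') s)
    (hC : ∀ r t, |r| ≤ A → |R r t| ≤ C ∧ |R₁ r t| ≤ C ∧ |R₂ r t| ≤ C) :
    HasWeakPartial Ω i (fun x => R (a x) (w x))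
      (fun x => R₁ (a x) (w x) * a' x (EuclideanSpace.single i 1) + R₂ (a x) (w x) * g x) := by
  have hΩm := hΩ.measurableSet
  have hac : ContinuousOn a Ω := fun x hx => (ha x hx).continuousAt.continuousWithinAt
  have ham : AEStronglyMeasurable a (volume.restrict Ω) := hac.aestronglyMeasurable hΩm
  have hwm := h.1.aestronglyMeasurable
  have hgm := h.2.1.aestronglyMeasurable
  set v : Eucl n := EuclideanSpace.single i 1 with hv
  have hav : ContinuousOn (fun x => a' x v) Ω := ha'.clm_apply continuousOn_const
  have havm : AEStronglyMeasurable (fun x => a' x v) (volume.restrict Ω) :=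
    hav.aestronglyMeasurable hΩm
  have hcomp : ∀ {Q : ℝ → ℝ → ℝ}, Continuous (Function.uncurry Q) →
      AEStronglyMeasurable (fun x => Q (a x) (w x)) (volume.restrict Ω) := fun hQ =>
    hQ.comp_aestronglyMeasurable (ham.prodMk hwm)
  have hloc : ∀ {f b : Eucl n → ℝ}, LocallyIntegrableOn b Ω →
      AEStronglyMeasurable f (volume.restrict Ω) → (∀ x ∈ Ω, |f x| ≤ |b x|) →
      LocallyIntegrableOn f Ω := by
    intro f b hb hf hfb
    rw [locallyIntegrableOn_iff hΩ.isLocallyClosed] at hb ⊢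
    intro K hK hKc
    refine Integrable.mono (hb K hK hKc) (hf.mono_measure (Measure.restrict_mono hK le_rfl)) ?_
    exact ae_restrict_of_forall_mem hKc.measurableSet fun x hx => hfb x (hK hx)
  refine ⟨?_, ?_, ?_⟩
  · exact hloc (b := fun _ => C) (locallyIntegrableOn_const C) (hcomp hR)
      fun x hx => ((hC _ _ (haA x hx)).1).trans (le_abs_self C)
  · refine (hloc (b := fun x => C * a' x v) ?_ ((hcomp hR₁).mul havm) fun x hx => ?_).add
      (hloc (b := fun x => C * g x) ?_ ((hcomp hR₂).mul hgm) fun x hx => ?_)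
    · exact (continuousOn_const.mul hav).locallyIntegrableOn hΩm
    · rw [Pi.mul_apply, abs_mul, abs_mul]
      exact mul_le_mul_of_nonneg_right (((hC _ _ (haA x hx)).2.1).trans (le_abs_self C))
        (abs_nonneg _)
    · exact h.2.1.smul C
    · rw [abs_mul, abs_mul]
      exact mul_le_mul_of_nonneg_right (((hC _ _ (haA x hx)).2.2).trans (le_abs_self C))
        (abs_nonneg _)
  intro η hη hηc hηΩ
  have hηv := hη.continuous_fderiv_apply_const v
  have hηvc := hηc.fderiv_apply_const v
  have hηvs := tsupport_fderiv_apply_const_subset η v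
  rw [setIntegral_eq_integral_of_tsupport_subset hηΩ,
    setIntegral_eq_integral_of_tsupport_subset (hηvs.trans hηΩ)]
  -- The cutoff is 1 in a neighbourhood of supp η, so its derivative vanishes there too and the
  -- localized pair (w₁, g₁) agrees with (w, g) on supp η.
  obtain ⟨χ, hχ, hχc, hχΩ, hχ1⟩ := exists_cutoff hΩ hηc hηΩ
  set w₁ : Eucl n → ℝ := fun x => w x * χ x with hw₁
  set g₁ : Eucl n → ℝ := fun x => g x * χ x + w x * fderiv ℝ χ x v with hg₁
  have hw₁i : Integrable w₁ := h.1.integrable_mul_of_tsupport_subset hχ.continuous hχc hχΩ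
  have hg₁i : Integrable g₁ :=
    (h.2.1.integrable_mul_of_tsupport_subset hχ.continuous hχc hχΩ).add
      (h.1.integrable_mul_of_tsupport_subset (hχ.continuous_fderiv_apply_const v)
        (hχc.fderiv_apply_const v) ((tsupport_fderiv_apply_const_subset χ v).trans hχΩ))
  have hw₁eq : ∀ x ∈ tsupport η, w₁ x = w x := fun x hx => by
    simp only [hw₁, (hχ1 x hx).eq_of_nhds, mul_one]
  have hg₁eq : ∀ x ∈ tsupport η, g₁ x = g x := fun x hx => by
    simp only [hg₁, (hχ1 x hx).eq_of_nhds, mul_one, (hχ1 x hx).fderiv_eq]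
    simp
  obtain ⟨W, G, hW, hG, hGi, hWG, hWt, hGt⟩ := exists_mollified_seq hw₁i hg₁i
    (fun η hη _ => h.mul_cutoff hχ hχc hχΩ hη)
  have hcon : ∀ {Q : ℝ → ℝ → ℝ}, Continuous (Function.uncurry Q) → ∀ k,
      ContinuousOn (fun x => Q (a x) (W k x)) Ω := fun hQ k =>
    hQ.comp_continuousOn (hac.prodMk (hW k).continuousOn)
  have hsuppη : ∀ f : Eucl n → ℝ, HasCompactSupport fun x => f x * η x := fun f => hηc.mul_left
  -- For the mollified functions the chain rule is classical, and this is integration by parts along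
  -- v.
  have hibp : ∀ k, ∫ x, R (a x) (W k x) * fderiv ℝ η x v =
      - ((∫ x, R₁ (a x) (W k x) * a' x v * η x) + ∫ x, R₂ (a x) (W k x) * η x * G k x) := by
    intro k
    have i1 : Integrable fun x => R₁ (a x) (W k x) * a' x v * η x :=
      (((hcon hR₁ k).mul hav).continuous_mul_of_tsupport_subset hΩ hη.continuous
        hηΩ).integrable_of_hasCompactSupport (hsuppη _)
    have i2 : Integrable fun x => R₂ (a x) (W k x) * G k x * η x :=
      (((hcon hR₂ k).mul (hG k).continuousOn).continuous_mul_of_tsupport_subset hΩ hη.continuous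
        hηΩ).integrable_of_hasCompactSupport (hsuppη _)
    have i0 : Integrable fun x => R (a x) (W k x) * η x :=
      ((hcon hR k).continuous_mul_of_tsupport_subset hΩ hη.continuous
        hηΩ).integrable_of_hasCompactSupport (hsuppη _)
    have i3 : Integrable fun x => R (a x) (W k x) * fderiv ℝ η x v :=
      ((hcon hR k).continuous_mul_of_tsupport_subset hΩ hηv
        (hηvs.trans hηΩ)).integrable_of_hasCompactSupport hηvc.mul_left
    have hsum : ∀ x, (R₁ (a x) (W k x) * a' x v + R₂ (a x) (W k x) * G k x) * η x =
        R₁ (a x) (W k x) * a' x v * η x + R₂ (a x) (W k x) * G k x * η x := fun x => by ring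
    have key := integral_bilinear_hasLineDerivAt_right_eq_neg_left_of_integrable
      (μ := (volume : Measure (Eucl n))) (B := ContinuousLinearMap.mul ℝ ℝ) (v := v)
      (f := fun x => R (a x) (W k x)) (g := η)
      (f' := fun x => R₁ (a x) (W k x) * a' x v + R₂ (a x) (W k x) * G k x)
      (g' := fun x => fderiv ℝ η x v)
      (by
        simp only [ContinuousLinearMap.mul_apply']
        simp_rw [hsum]
        exact i1.add i2) i3 i0 ?_ ?_
    · simp only [ContinuousLinearMap.mul_apply'] at key
      simp_rw [hsum] at key
      rw [integral_add i1 i2] at key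
      rw [key]
      congr 3
      funext x
      ring
    · intro x hx
      have h1 := (ha x (hηΩ hx)).hasLineDerivAt v
      have h2 := hWG k x
      -- A line derivative is an ordinary derivative at 0 along s ↦ x + s v, which is the form in
      -- which `hder` applies.
      have := hder _ _ _ _ 0 h1 h2
      simpa [HasLineDerivAt] using this
    · intro x _
      exact ((hη.differentiable (by simp)).differentiableAt.hasFDerivAt).hasLineDerivAt v
  have hpt : ∀ {Q : ℝ → ℝ → ℝ}, Continuous (Function.uncurry Q) →
      ∀ᵐ x, Tendsto (fun k => Q (a x) (W k x)) atTop (𝓝 (Q (a x) (w₁ x))) := by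
    intro Q hQ
    filter_upwards [hWt] with x hx
    exact (hQ.tendsto (a x, w₁ x)).comp (tendsto_const_nhds.prodMk_nhds hx)
  have hzero : ∀ x, x ∉ Ω → η x = 0 ∧ fderiv ℝ η x v = 0 := fun x hx =>
    ⟨image_eq_zero_of_notMem_tsupport fun hh => hx (hηΩ hh),
      image_eq_zero_of_notMem_tsupport (f := fun x => fderiv ℝ η x v)
        fun hh => hx (hηΩ (hηvs hh))⟩
  have t1 : Tendsto (fun k => ∫ x, R (a x) (W k x) * fderiv ℝ η x v) atTop
      (𝓝 (∫ x, R (a x) (w₁ x) * fderiv ℝ η x v)) := by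
    refine tendsto_integral_of_dominated_convergence (fun x => C * |fderiv ℝ η x v|) (fun k => ?_)
      ((hηv.integrable_of_hasCompactSupport hηvc).abs.const_mul C)
      (fun k => Eventually.of_forall fun x => ?_) ?_
    · exact ((hcon hR k).continuous_mul_of_tsupport_subset hΩ hηv
        (hηvs.trans hηΩ)).aestronglyMeasurable
    · rw [Real.norm_eq_abs, abs_mul]
      by_cases hx : x ∈ Ω
      · exact mul_le_mul_of_nonneg_right (hC _ _ (haA x hx)).1 (abs_nonneg _)
      · simp [(hzero x hx).2]
    · filter_upwards [hpt hR] with x hx using hx.mul_const _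
  have t2 : Tendsto (fun k => ∫ x, R₁ (a x) (W k x) * a' x v * η x) atTop
      (𝓝 (∫ x, R₁ (a x) (w₁ x) * a' x v * η x)) := by
    refine tendsto_integral_of_dominated_convergence (fun x => C * |a' x v * η x|) (fun k => ?_)
      (((hav.continuous_mul_of_tsupport_subset hΩ hη.continuous
        hηΩ).integrable_of_hasCompactSupport (hsuppη _)).abs.const_mul C)
      (fun k => Eventually.of_forall fun x => ?_) ?_
    · exact (((hcon hR₁ k).mul hav).continuous_mul_of_tsupport_subset hΩ hη.continuous
        hηΩ).aestronglyMeasurable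
    · rw [Real.norm_eq_abs, mul_assoc, abs_mul]
      by_cases hx : x ∈ Ω
      · exact mul_le_mul_of_nonneg_right (hC _ _ (haA x hx)).2.1 (abs_nonneg _)
      · simp [(hzero x hx).1]
    · filter_upwards [hpt hR₁] with x hx using (hx.mul_const _).mul_const _
  obtain ⟨D, hD⟩ := hηc.exists_bound_of_continuous hη.continuous
  have hBc : ∀ k, Continuous fun x => R₂ (a x) (W k x) * η x := fun k =>
    (hcon hR₂ k).continuous_mul_of_tsupport_subset hΩ hη.continuous hηΩ
  have hB : ∀ k x, |R₂ (a x) (W k x) * η x| ≤ |C| * |D| := by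
    intro k x
    rw [abs_mul]
    by_cases hx : x ∈ Ω
    · exact mul_le_mul (((hC _ _ (haA x hx)).2.2).trans (le_abs_self C))
        ((hD x).trans (le_abs_self D)) (abs_nonneg _) (abs_nonneg _)
    · rw [(hzero x hx).1, abs_zero, mul_zero]
      positivity
  have hBi : ∀ k {f : Eucl n → ℝ}, Integrable f →
      Integrable fun x => R₂ (a x) (W k x) * η x * f x := fun k f hf =>
    hf.bdd_mul (hBc k).aestronglyMeasurable (Eventually.of_forall (hB k))
  have t3 : Tendsto (fun k => ∫ x, R₂ (a x) (W k x) * η x * g₁ x) atTop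
      (𝓝 (∫ x, R₂ (a x) (w₁ x) * η x * g₁ x)) := by
    refine tendsto_integral_of_dominated_convergence (fun x => |C| * |D| * |g₁ x|)
      (fun k => (hBi k hg₁i).aestronglyMeasurable) (hg₁i.abs.const_mul _)
      (fun k => Eventually.of_forall fun x => ?_) ?_
    · rw [Real.norm_eq_abs, abs_mul]
      exact mul_le_mul_of_nonneg_right (hB k x) (abs_nonneg _)
    · filter_upwards [hpt hR₂] with x hx using (hx.mul_const _).mul_const _
  -- The product of two varying factors is split: here the error G k - g₁ tends to zero in L¹
  -- against a uniformly bounded factor, while in `t3` the integrable factor is fixed.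
  have t4 : Tendsto (fun k => ∫ x, R₂ (a x) (W k x) * η x * (G k x - g₁ x)) atTop (𝓝 0) := by
    have := hGt.const_mul (|C| * |D|)
    rw [mul_zero] at this
    refine squeeze_zero_norm (fun k => ?_) this
    refine (norm_integral_le_integral_norm _).trans ?_
    rw [← integral_const_mul]
    refine integral_mono (hBi k ((hGi k).sub hg₁i)).norm
      (((hGi k).sub hg₁i).abs.const_mul _) fun x => ?_
    simp only [Real.norm_eq_abs, abs_mul (R₂ (a x) (W k x) * η x)]
    exact mul_le_mul_of_nonneg_right (hB k x) (abs_nonneg _)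
  have t5 : Tendsto (fun k => ∫ x, R₂ (a x) (W k x) * η x * G k x) atTop
      (𝓝 (∫ x, R₂ (a x) (w₁ x) * η x * g₁ x)) := by
    have := t4.add t3
    rw [zero_add] at this
    refine this.congr fun k => ?_
    refine (integral_add (hBi k ((hGi k).sub hg₁i)) (hBi k hg₁i)).symm.trans ?_
    congr 1
    funext x
    simp only [Pi.sub_apply]
    ring
  have t6 := (t2.add t5).neg
  have hlim := tendsto_nhds_unique t1 (t6.congr fun k => (hibp k).symm)
  have e1 : ∀ x, R (a x) (w x) * fderiv ℝ η x v = R (a x) (w₁ x) * fderiv ℝ η x v := by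
    intro x
    by_cases hx : x ∈ tsupport η
    · rw [hw₁eq x hx]
    · have : fderiv ℝ η x v = 0 :=
        image_eq_zero_of_notMem_tsupport (f := fun x => fderiv ℝ η x v) fun hh => hx (hηvs hh)
      simp [this]
  have e2 : ∀ x, (R₁ (a x) (w x) * a' x v + R₂ (a x) (w x) * g x) * η x =
      R₁ (a x) (w₁ x) * a' x v * η x + R₂ (a x) (w₁ x) * η x * g₁ x := by
    intro x
    by_cases hx : x ∈ tsupport η
    · rw [hw₁eq x hx, hg₁eq x hx]; ring
    · simp [image_eq_zero_of_notMem_tsupport hx]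
  simp_rw [e1, e2]
  rw [integral_add ?_ ?_, hlim]
  · have hbd : ∀ᵐ x, ‖R₁ (a x) (w₁ x) * (a' x v * η x)‖ ≤ C * |a' x v * η x| :=
      Eventually.of_forall fun x => by
        rw [Real.norm_eq_abs, abs_mul]
        by_cases hx : x ∈ Ω
        · exact mul_le_mul_of_nonneg_right (hC _ _ (haA x hx)).2.1 (abs_nonneg _)
        · simp [(hzero x hx).1]
    -- Nothing is assumed about a outside Ω; measurability on the whole space comes from continuous
    -- approximants that vanish off supp η.
    have hm : AEStronglyMeasurable (fun x => R₁ (a x) (w₁ x) * (a' x v * η x)) := by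
      refine aestronglyMeasurable_of_tendsto_ae atTop (f := fun k x =>
        R₁ (a x) (W k x) * (a' x v * η x)) (fun k => ?_) ?_
      · simp_rw [← mul_assoc]
        exact (((hcon hR₁ k).mul hav).continuous_mul_of_tsupport_subset hΩ hη.continuous
          hηΩ).aestronglyMeasurable
      · filter_upwards [hpt hR₁] with x hx using hx.mul_const _
    simp_rw [mul_assoc]
    exact (((hav.continuous_mul_of_tsupport_subset hΩ hη.continuous
        hηΩ).integrable_of_hasCompactSupport (hsuppη _)).abs.const_mul C).mono' hm hbd
  · have hm : AEStronglyMeasurable (fun x => R₂ (a x) (w₁ x) * η x) := by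
      refine aestronglyMeasurable_of_tendsto_ae atTop (f := fun k x =>
        R₂ (a x) (W k x) * η x) (fun k => (hBc k).aestronglyMeasurable) ?_
      filter_upwards [hpt hR₂] with x hx using hx.mul_const _
    refine hg₁i.bdd_mul (c := |C| * |D|) hm (Eventually.of_forall fun x => ?_)
    rw [Real.norm_eq_abs, abs_mul]
    by_cases hx : x ∈ Ω
    · exact mul_le_mul (((hC _ _ (haA x hx)).2.2).trans (le_abs_self C))
        ((hD x).trans (le_abs_self D)) (abs_nonneg _) (abs_nonneg _)
    · rw [(hzero x hx).1, abs_zero, mul_zero]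
      positivity

/-- Weak derivatives are stable under dominated almost everywhere convergence. -/
theorem HasWeakPartial.of_tendsto {n : ℕ} {Ω : Set (Eucl n)} (hΩ : IsOpen Ω) {i : Fin n}
    {h g : Eucl n → ℝ} {hs gs : ℕ → Eucl n → ℝ} {H G : Eucl n → ℝ}
    (hk : ∀ k, HasWeakPartial Ω i (hs k) (gs k))
    (hH : LocallyIntegrableOn H Ω) (hG : LocallyIntegrableOn G Ω)
    (hhH : ∀ᵐ x ∂((volume : Measure (Eucl n)).restrict Ω), ∀ k, |hs k x| ≤ H x)
    (hgG : ∀ᵐ x ∂((volume : Measure (Eucl n)).restrict Ω), ∀ k, |gs k x| ≤ G x)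
    (hlim : ∀ᵐ x ∂((volume : Measure (Eucl n)).restrict Ω),
      Tendsto (fun k => hs k x) atTop (𝓝 (h x)))
    (glim : ∀ᵐ x ∂((volume : Measure (Eucl n)).restrict Ω),
      Tendsto (fun k => gs k x) atTop (𝓝 (g x))) :
    HasWeakPartial Ω i h g := by
  have hloc : ∀ {f F : Eucl n → ℝ} {fs : ℕ → Eucl n → ℝ}, LocallyIntegrableOn F Ω →
      (∀ k, LocallyIntegrableOn (fs k) Ω) →
      (∀ᵐ x ∂((volume : Measure (Eucl n)).restrict Ω), ∀ k, |fs k x| ≤ F x) →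
      (∀ᵐ x ∂((volume : Measure (Eucl n)).restrict Ω),
        Tendsto (fun k => fs k x) atTop (𝓝 (f x))) → LocallyIntegrableOn f Ω := by
    intro f F fs hF hfs hb hl
    have hm : AEStronglyMeasurable f (volume.restrict Ω) :=
      aestronglyMeasurable_of_tendsto_ae atTop (fun k => (hfs k).aestronglyMeasurable) hl
    rw [locallyIntegrableOn_iff hΩ.isLocallyClosed] at hF ⊢
    intro K hK hKc
    refine (hF K hK hKc).mono' (hm.mono_measure (Measure.restrict_mono hK le_rfl)) ?_
    refine ae_restrict_of_ae_restrict_of_subset hK ?_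
    filter_upwards [hb, hl] with x h1 h2
    exact le_of_tendsto h2.abs (Eventually.of_forall h1)
  have hconv : ∀ {f F η : Eucl n → ℝ} {fs : ℕ → Eucl n → ℝ}, LocallyIntegrableOn F Ω →
      (∀ k, LocallyIntegrableOn (fs k) Ω) →
      (∀ᵐ x ∂((volume : Measure (Eucl n)).restrict Ω), ∀ k, |fs k x| ≤ F x) →
      (∀ᵐ x ∂((volume : Measure (Eucl n)).restrict Ω),
        Tendsto (fun k => fs k x) atTop (𝓝 (f x))) → Continuous η → HasCompactSupport η →
      tsupport η ⊆ Ω →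
      Tendsto (fun k => ∫ x in Ω, fs k x * η x) atTop (𝓝 (∫ x in Ω, f x * η x)) := by
    intro f F η fs hF hfs hb hl hη hηc hηΩ
    refine tendsto_integral_of_dominated_convergence (fun x => |F x * η x|)
      (fun k => ((hfs k).integrable_mul_of_tsupport_subset hη hηc
        hηΩ).aestronglyMeasurable.restrict)
      (hF.integrable_mul_of_tsupport_subset hη hηc hηΩ).abs.restrict (fun k => ?_) ?_
    · filter_upwards [hb] with x h1
      rw [Real.norm_eq_abs, abs_mul, abs_mul]
      exact mul_le_mul_of_nonneg_right ((h1 k).trans (le_abs_self _)) (abs_nonneg _)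
    · filter_upwards [hl] with x h1 using h1.mul_const _
  refine ⟨hloc hH (fun k => (hk k).1) hhH hlim, hloc hG (fun k => (hk k).2.1) hgG glim,
    fun η hη hηc hηΩ => ?_⟩
  have t1 := hconv hH (fun k => (hk k).1) hhH hlim
    (hη.continuous_fderiv_apply_const (EuclideanSpace.single i 1)) (hηc.fderiv_apply_const _)
    ((tsupport_fderiv_apply_const_subset _ _).trans hηΩ)
  have t2 := hconv hG (fun k => (hk k).2.1) hgG glim hη.continuous hηc hηΩ
  exact tendsto_nhds_unique t1 (t2.neg.congr fun k => ((hk k).2.2 η hη hηc hηΩ).symm)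

/-! ### Bounding large values with the arctangent -/

/-- A smooth bounded odd approximation of the identity as `δ → 0`. -/
noncomputable def damp (δ t : ℝ) : ℝ := Real.arctan (δ * t) / δ

/-- The derivative of `damp δ`. -/
noncomputable def dampDeriv (δ t : ℝ) : ℝ := 1 / (1 + (δ * t) ^ 2)

theorem damp_zero (δ : ℝ) : damp δ 0 = 0 := by simp [damp]

theorem hasDerivAt_damp {δ : ℝ} (hδ : δ ≠ 0) (t : ℝ) :
    HasDerivAt (damp δ) (dampDeriv δ t) t := by
  have h := (((hasDerivAt_id t).const_mul δ).arctan).div_const δ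
  convert! h using 1
  simp only [dampDeriv, id]
  field_simp

theorem dampDeriv_nonneg (δ t : ℝ) : 0 ≤ dampDeriv δ t := by
  unfold dampDeriv; positivity

theorem dampDeriv_le_one (δ t : ℝ) : dampDeriv δ t ≤ 1 := by
  unfold dampDeriv
  rw [div_le_one (by positivity)]
  nlinarith [sq_nonneg (δ * t)]

/-- The difference quotient of arctan at 0 extends continuously by the value 1, so the limit δ → 0
can be taken without dividing by δ, even when t varies too. -/
theorem damp_eq_mul_dslope {δ : ℝ} (hδ : δ ≠ 0) (t : ℝ) :
    damp δ t = t * dslope Real.arctan 0 (δ * t) := by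
  rcases eq_or_ne t 0 with rfl | ht
  · simp [damp_zero]
  · rw [dslope_of_ne _ (mul_ne_zero hδ ht), slope_def_field, damp]
    simp only [Real.arctan_zero, sub_zero]
    field_simp

theorem abs_damp_le {δ : ℝ} (hδ : 0 < δ) (t : ℝ) : |damp δ t| ≤ |t| := by
  have h : ‖damp δ t - damp δ 0‖ ≤ 1 * ‖t - 0‖ := by
    refine convex_univ.norm_image_sub_le_of_norm_hasDerivWithin_le
      (fun x _ => (hasDerivAt_damp hδ.ne' x).hasDerivWithinAt) (fun x _ => ?_)
      (mem_univ _) (mem_univ _)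
    rw [Real.norm_eq_abs, abs_of_nonneg (dampDeriv_nonneg _ _)]
    exact dampDeriv_le_one _ _
  simpa [damp_zero] using h

theorem abs_damp_le_const {δ : ℝ} (hδ : 0 < δ) (t : ℝ) : |damp δ t| ≤ Real.pi / 2 / δ := by
  rw [damp, abs_div, abs_of_pos hδ]
  refine div_le_div_of_nonneg_right (abs_le.2 ⟨?_, ?_⟩) hδ.le
  · linarith [Real.neg_pi_div_two_lt_arctan (δ * t)]
  · exact (Real.arctan_lt_pi_div_two _).le

theorem damp_nonneg {δ t : ℝ} (hδ : 0 < δ) (ht : 0 ≤ t) : 0 ≤ damp δ t :=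
  div_nonneg (Real.arctan_nonneg.2 (mul_nonneg hδ.le ht)) hδ.le

theorem damp_neg (δ t : ℝ) : damp δ (-t) = -damp δ t := by
  simp [damp, Real.arctan_neg, neg_div]

theorem tendsto_damp {δ t : ℕ → ℝ} {t₀ : ℝ} (hδ0 : ∀ k, 0 < δ k)
    (hδ : Tendsto δ atTop (𝓝 0)) (ht : Tendsto t atTop (𝓝 t₀)) :
    Tendsto (fun k => damp (δ k) (t k)) atTop (𝓝 t₀) := by
  have h1 : ContinuousAt (dslope Real.arctan 0) 0 :=
    continuousAt_dslope_same.2 Real.differentiable_arctan.differentiableAt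
  have h2 : Tendsto (fun k => δ k * t k) atTop (𝓝 0) := by simpa using hδ.mul ht
  have h3 := ht.mul (h1.tendsto.comp h2)
  simp only [dslope_same, Real.deriv_arctan] at h3
  norm_num at h3
  exact h3.congr fun k => (damp_eq_mul_dslope (hδ0 k).ne' (t k)).symm

theorem tendsto_dampDeriv {δ t : ℕ → ℝ} {t₀ : ℝ}
    (hδ : Tendsto δ atTop (𝓝 0)) (ht : Tendsto t atTop (𝓝 t₀)) :
    Tendsto (fun k => dampDeriv (δ k) (t k)) atTop (𝓝 1) := by
  have h2 : Tendsto (fun k => δ k * t k) atTop (𝓝 0) := by simpa using hδ.mul ht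
  have h3 : Tendsto (fun k => 1 / (1 + (δ k * t k) ^ 2)) atTop (𝓝 (1 / (1 + 0 ^ 2))) :=
    tendsto_const_nhds.div (tendsto_const_nhds.add (h2.pow 2)) (by norm_num)
  simpa [dampDeriv] using h3

theorem continuous_damp (δ : ℝ) : Continuous (damp δ) := by
  unfold damp; fun_prop

theorem continuous_dampDeriv (δ : ℝ) : Continuous (dampDeriv δ) := by
  unfold dampDeriv
  exact continuous_const.div (by fun_prop) fun t => by positivity

/-- Chain rule for `R (a x) (damp δ (w x))`, where `R` and `a` are `C¹`. -/
theorem HasWeakPartial.comp_damp {n : ℕ} {Ω : Set (Eucl n)} (hΩ : IsOpen Ω) {i : Fin n}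
    {w g a : Eucl n → ℝ} {a' : Eucl n → (Eucl n →L[ℝ] ℝ)} {A δ : ℝ} (hδ : 0 < δ)
    (h : HasWeakPartial Ω i w g)
    (ha : ∀ x ∈ Ω, HasFDerivAt a (a' x) x) (ha' : ContinuousOn a' Ω)
    (haA : ∀ x ∈ Ω, |a x| ≤ A)
    {R R₁ R₂ : ℝ → ℝ → ℝ} (hR : Continuous (Function.uncurry R))
    (hR₁ : Continuous (Function.uncurry R₁)) (hR₂ : Continuous (Function.uncurry R₂))
    (hder : ∀ (p q : ℝ → ℝ) (p' q' s : ℝ), HasDerivAt p p' s → HasDerivAt q q' s →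
      HasDerivAt (fun s => R (p s) (q s)) (R₁ (p s) (q s) * p' + R₂ (p s) (q s) * q') s) :
    HasWeakPartial Ω i (fun x => R (a x) (damp δ (w x)))
      (fun x => R₁ (a x) (damp δ (w x)) * a' x (EuclideanSpace.single i 1) +
        R₂ (a x) (damp δ (w x)) * dampDeriv δ (w x) * g x) := by
  -- The pair (a, damp δ w) stays in a compact rectangle, so continuity alone gives the bounds that
  -- `comp_bounded` asks for.
  have hbd : ∀ {Q : ℝ → ℝ → ℝ}, Continuous (Function.uncurry Q) →
      ∃ C, ∀ r t, |r| ≤ A → |Q r (damp δ t)| ≤ C := by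
    intro Q hQ
    obtain ⟨C, hC⟩ := (isCompact_Icc.prod isCompact_Icc :
      IsCompact (Icc (-A) A ×ˢ Icc (-(Real.pi / 2 / δ)) (Real.pi / 2 / δ))
      ).exists_bound_of_continuousOn
      hQ.continuousOn
    exact ⟨C, fun r t hr => hC (r, damp δ t) ⟨abs_le.1 hr, abs_le.1 (abs_damp_le_const hδ t)⟩⟩
  obtain ⟨C, hC⟩ := hbd hR
  obtain ⟨C₁, hC₁⟩ := hbd hR₁
  obtain ⟨C₂, hC₂⟩ := hbd hR₂
  have hcd : ∀ {Q : ℝ → ℝ → ℝ}, Continuous (Function.uncurry Q) →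
      Continuous (Function.uncurry fun r t => Q r (damp δ t)) := fun hQ =>
    hQ.comp (continuous_fst.prodMk ((continuous_damp δ).comp continuous_snd))
  refine h.comp_bounded hΩ (C := max C (max C₁ C₂)) ha ha' haA
    (R := fun r t => R r (damp δ t)) (R₁ := fun r t => R₁ r (damp δ t))
    (R₂ := fun r t => R₂ r (damp δ t) * dampDeriv δ t) (hcd hR) (hcd hR₁)
    ((hcd hR₂).mul ((continuous_dampDeriv δ).comp continuous_snd)) ?_ fun r t hr => ⟨?_, ?_, ?_⟩
  · intro p q p' q' s hp hq
    have := hder p (fun s => damp δ (q s)) p' _ s hp ((hasDerivAt_damp hδ.ne' (q s)).comp s hq)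
    convert! this using 1
    ring
  · exact (hC r t hr).trans (le_max_left _ _)
  · exact (hC₁ r t hr).trans ((le_max_left _ _).trans (le_max_right _ _))
  · rw [abs_mul, abs_of_nonneg (dampDeriv_nonneg _ _)]
    exact (mul_le_of_le_one_right (abs_nonneg _) (dampDeriv_le_one _ _)).trans
      ((hC₂ r t hr).trans ((le_max_right _ _).trans (le_max_right _ _)))

/-! ### The truncation near zero -/

/-- Each of the two one-sided positive parts has the smooth approximation `softPos`. -/
theorem cutNearZero_eq {ε : ℝ} (hε : 0 < ε) (t : ℝ) :
    cutNearZero ε t = max (t - ε) 0 - max (-t - ε) 0 := by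
  unfold cutNearZero
  rcases le_total t ε with h1 | h1 <;> rcases le_total (-ε) t with h2 | h2
  · rw [min_eq_right h1, max_eq_right h2, max_eq_right (by linarith), max_eq_right (by linarith)]
    ring
  · rw [min_eq_right h1, max_eq_left h2, max_eq_right (by linarith), max_eq_left (by linarith)]
    ring
  · rw [min_eq_left h1, max_eq_right (by linarith), max_eq_left (by linarith),
      max_eq_right (by linarith)]
    ring
  · linarith

theorem abs_cutNearZero_le {ε : ℝ} (hε : 0 < ε) (t : ℝ) : |cutNearZero ε t| ≤ |t| := by
  rw [cutNearZero_eq hε]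
  rcases le_total 0 t with h | h
  · rw [max_eq_right (a := -t - ε) (by linarith), sub_zero, abs_of_nonneg (le_max_right _ _),
      abs_of_nonneg h]
    exact max_le (by linarith) h
  · rw [max_eq_right (a := t - ε) (by linarith), zero_sub, abs_neg,
      abs_of_nonneg (le_max_right _ _), abs_of_nonpos h]
    exact max_le (by linarith) (by linarith)

theorem cutNearZero_zero {ε : ℝ} (hε : 0 < ε) : cutNearZero ε 0 = 0 := by
  simpa using abs_cutNearZero_le hε 0

theorem continuous_cutNearZero : Continuous fun p : ℝ × ℝ => cutNearZero p.1 p.2 := by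
  unfold cutNearZero; fun_prop

theorem tendsto_cutNearZero {ε t : ℕ → ℝ} {ε₀ t₀ : ℝ} (hε : Tendsto ε atTop (𝓝 ε₀))
    (ht : Tendsto t atTop (𝓝 t₀)) :
    Tendsto (fun k => cutNearZero (ε k) (t k)) atTop (𝓝 (cutNearZero ε₀ t₀)) :=
  (continuous_cutNearZero.tendsto (ε₀, t₀)).comp (hε.prodMk_nhds ht)

theorem cutNearZero_zero_left (t : ℝ) : cutNearZero 0 t = t := by
  unfold cutNearZero
  rcases le_total 0 t with h | h <;> simp [h]

/-- A `C¹` approximation (as `δ → 0`) of the positive part of `t - ε`. -/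
noncomputable def softPos (ε δ t : ℝ) : ℝ := Real.sqrt (max (t - ε) 0 ^ 2 + δ ^ 2)

/-- The derivative of `softPos ε δ`. -/
noncomputable def softPosDeriv (ε δ t : ℝ) : ℝ :=
  max (t - ε) 0 / Real.sqrt (max (t - ε) 0 ^ 2 + δ ^ 2)

/-- Squaring removes the corner: at 0 the function is at most t², hence o(t). This is what makes
`softPos` differentiable. -/
theorem hasDerivAt_max_zero_sq (t : ℝ) : HasDerivAt (fun t => max t 0 ^ 2) (2 * max t 0) t := by
  rcases lt_trichotomy t 0 with h | rfl | h
  · rw [max_eq_right h.le, mul_zero]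
    refine (hasDerivAt_const t (0 : ℝ)).congr_of_eventuallyEq ?_
    filter_upwards [Iio_mem_nhds h] with s hs
    rw [max_eq_right (le_of_lt hs)]; norm_num
  · rw [max_self, mul_zero]
    rw [hasDerivAt_iff_isLittleO]
    simp only [max_self, sub_zero, smul_eq_mul, mul_zero, ne_eq, OfNat.ofNat_ne_zero,
      not_false_eq_true, zero_pow]
    refine Asymptotics.IsBigO.trans_isLittleO (g := fun s : ℝ => s ^ 2) ?_
      (Asymptotics.isLittleO_pow_id one_lt_two)
    refine Asymptotics.IsBigO.of_bound 1 (Eventually.of_forall fun s => ?_)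
    rw [one_mul, norm_pow, norm_pow]
    refine pow_le_pow_left₀ (norm_nonneg _) ?_ 2
    rw [Real.norm_eq_abs, abs_of_nonneg (le_max_right _ _)]
    exact max_le (le_abs_self _) (abs_nonneg _)
  · rw [max_eq_left h.le]
    have := (hasDerivAt_pow 2 t)
    norm_num at this
    refine this.congr_of_eventuallyEq ?_
    filter_upwards [Ioi_mem_nhds h] with s hs
    rw [max_eq_left (le_of_lt hs)]

theorem softPos_radicand_pos {δ : ℝ} (hδ : 0 < δ) (r : ℝ) : 0 < r ^ 2 + δ ^ 2 := by positivity

theorem hasDerivAt_softPos {ε δ : ℝ} (hδ : 0 < δ) (t : ℝ) :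
    HasDerivAt (softPos ε δ) (softPosDeriv ε δ t) t := by
  have h0 : HasDerivAt (fun t => t - ε) 1 t := (hasDerivAt_id t).sub_const ε
  have h1 : HasDerivAt (fun t => max (t - ε) 0 ^ 2) (2 * max (t - ε) 0 * 1) t :=
    HasDerivAt.comp (h₂ := fun t => max t 0 ^ 2) t (hasDerivAt_max_zero_sq (t - ε)) h0
  have h2 := (h1.add_const (δ ^ 2)).sqrt (softPos_radicand_pos hδ _).ne'
  convert! h2 using 1
  unfold softPosDeriv
  have := (Real.sqrt_pos.2 (softPos_radicand_pos hδ (max (t - ε) 0))).ne'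
  field_simp

theorem softPosDeriv_nonneg (ε δ t : ℝ) : 0 ≤ softPosDeriv ε δ t :=
  div_nonneg (le_max_right _ _) (Real.sqrt_nonneg _)

theorem softPosDeriv_le_one (ε δ t : ℝ) : softPosDeriv ε δ t ≤ 1 := by
  refine div_le_one_of_le₀ ?_ (Real.sqrt_nonneg _)
  refine Real.le_sqrt_of_sq_le ?_
  nlinarith [sq_nonneg δ]

/-- The vanishing is exact for every δ and includes t = ε. Hence the limit derivative is the
indicator of the strict set {|w| > ε}, with no information needed about g on {|w| = ε}. -/
theorem softPosDeriv_eq_zero {ε t : ℝ} (δ : ℝ) (h : t ≤ ε) : softPosDeriv ε δ t = 0 := by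
  rw [softPosDeriv, max_eq_right (by linarith), zero_div]

theorem softPos_nonneg (ε δ t : ℝ) : 0 ≤ softPos ε δ t := Real.sqrt_nonneg _

theorem softPos_le {ε δ t : ℝ} (hε : 0 < ε) (hδ : 0 < δ) (hδ1 : δ ≤ 1) :
    softPos ε δ t ≤ |t| + 1 := by
  refine Real.sqrt_le_iff.2 ⟨by positivity, ?_⟩
  have h1 : max (t - ε) 0 ≤ |t| := max_le (by linarith [le_abs_self t]) (abs_nonneg t)
  have h2 : 0 ≤ max (t - ε) 0 := le_max_right _ _
  nlinarith [abs_nonneg t]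

theorem tendsto_softPos {ε t₀ : ℝ} {δ t : ℕ → ℝ} (hδ : Tendsto δ atTop (𝓝 0))
    (ht : Tendsto t atTop (𝓝 t₀)) :
    Tendsto (fun k => softPos ε (δ k) (t k)) atTop (𝓝 (max (t₀ - ε) 0)) := by
  have h1 : Continuous fun p : ℝ × ℝ => Real.sqrt (max (p.2 - ε) 0 ^ 2 + p.1 ^ 2) := by fun_prop
  have h2 := (h1.tendsto (0, t₀)).comp (hδ.prodMk_nhds ht)
  simpa [Function.comp_def, Real.sqrt_sq, softPos] using h2

theorem tendsto_softPosDeriv {ε t₀ : ℝ} {δ t : ℕ → ℝ} (hδ : Tendsto δ atTop (𝓝 0))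
    (ht : Tendsto t atTop (𝓝 t₀)) (h : ε < t₀) :
    Tendsto (fun k => softPosDeriv ε (δ k) (t k)) atTop (𝓝 1) := by
  have h1 : Continuous fun t : ℝ => max (t - ε) 0 := by fun_prop
  have h2 := ((h1.tendsto t₀).comp ht).div (tendsto_softPos (ε := ε) hδ ht)
    (by rw [max_eq_left (by linarith)]; linarith)
  rw [div_self (by rw [max_eq_left (by linarith)]; linarith)] at h2
  exact h2

theorem continuous_softPosDeriv {ε δ : ℝ} (hδ : 0 < δ) : Continuous (softPosDeriv ε δ) := by
  unfold softPosDeriv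
  exact Continuous.div (by fun_prop) (by fun_prop)
    fun t => (Real.sqrt_pos.2 (softPos_radicand_pos hδ _)).ne'

/-- The sequence `1 / (k + 1)` used as the regularization parameter. -/
noncomputable def smallSeq (k : ℕ) : ℝ := 1 / ((k : ℝ) + 1)

theorem smallSeq_pos (k : ℕ) : 0 < smallSeq k := by unfold smallSeq; positivity

theorem smallSeq_le_one (k : ℕ) : smallSeq k ≤ 1 := by
  unfold smallSeq
  rw [div_le_one (by positivity)]
  linarith [(Nat.cast_nonneg k : (0 : ℝ) ≤ k)]

theorem tendsto_smallSeq : Tendsto smallSeq atTop (𝓝 0) := tendsto_one_div_add_atTop_nhds_zero_nat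

/-- Removing the values `|w| ≤ ε` multiplies the weak derivative by `1_{|w| > ε}`. -/
theorem HasWeakPartial.cutNearZero {n : ℕ} {Ω : Set (Eucl n)} (hΩ : IsOpen Ω) {i : Fin n}
    {w g : Eucl n → ℝ} (h : HasWeakPartial Ω i w g) {ε : ℝ} (hε : 0 < ε) :
    HasWeakPartial Ω i (fun x => cutNearZero ε (w x)) ({x | ε < |w x|}.indicator g) := by
  have hk : ∀ k, HasWeakPartial Ω i
      (fun x => softPos ε (smallSeq k) (damp (smallSeq k) (w x)) -
        softPos ε (smallSeq k) (-damp (smallSeq k) (w x)))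
      (fun x => 0 * (0 : Eucl n →L[ℝ] ℝ) (EuclideanSpace.single i 1) +
        (softPosDeriv ε (smallSeq k) (damp (smallSeq k) (w x)) +
          softPosDeriv ε (smallSeq k) (-damp (smallSeq k) (w x))) *
          dampDeriv (smallSeq k) (w x) * g x) := by
    intro k
    have hd := hasDerivAt_softPos (ε := ε) (smallSeq_pos k)
    have hc : Continuous (softPos ε (smallSeq k)) :=
      continuous_iff_continuousAt.2 fun t => (hd t).continuousAt
    have hc' := continuous_softPosDeriv (ε := ε) (smallSeq_pos k)
    -- There is no variable coefficient here, so a is the constant 0.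
    refine h.comp_damp hΩ (smallSeq_pos k) (a := fun _ => 0) (a' := fun _ => 0) (A := 0)
      (R := fun _ c => softPos ε (smallSeq k) c - softPos ε (smallSeq k) (-c))
      (R₁ := fun _ _ => 0)
      (R₂ := fun _ c => softPosDeriv ε (smallSeq k) c + softPosDeriv ε (smallSeq k) (-c))
      (fun x _ => hasFDerivAt_const _ _) continuousOn_const (fun x _ => by simp)
      ((hc.comp continuous_snd).sub (hc.comp continuous_snd.neg)) continuous_const
      ((hc'.comp continuous_snd).add (hc'.comp continuous_snd.neg)) ?_
    intro p q p' q' s _ hq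
    have h2 : HasDerivAt (fun s => softPos ε (smallSeq k) (-q s))
      (softPosDeriv ε (smallSeq k) (-q s) * -q') s :=
      HasDerivAt.comp (h₂ := softPos ε (smallSeq k)) s (hd (-q s)) hq.neg
    convert! ((hd (q s)).comp s hq).sub h2 using 1
    ring
  refine HasWeakPartial.of_tendsto hΩ hk (H := fun x => |w x| + 1) (G := fun x => 2 * |g x|)
    (h.1.norm.add (locallyIntegrableOn_const _)) (h.2.1.norm.smul (2 : ℝ))
    (Eventually.of_forall fun x k => ?_) (Eventually.of_forall fun x k => ?_)
    (Eventually.of_forall fun x => ?_) (Eventually.of_forall fun x => ?_)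
  · have h0 := abs_damp_le (smallSeq_pos k) (w x)
    have h1 := softPos_le (t := damp (smallSeq k) (w x)) hε (smallSeq_pos k) (smallSeq_le_one k)
    have h2 := softPos_le (t := -damp (smallSeq k) (w x)) hε (smallSeq_pos k) (smallSeq_le_one k)
    rw [abs_neg] at h2
    have h3 := softPos_nonneg ε (smallSeq k) (damp (smallSeq k) (w x))
    have h4 := softPos_nonneg ε (smallSeq k) (-damp (smallSeq k) (w x))
    exact abs_le.2 ⟨by linarith, by linarith⟩
  · rw [zero_mul, zero_add, abs_mul]
    refine mul_le_mul_of_nonneg_right ?_ (abs_nonneg _)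
    have h1 := softPosDeriv_nonneg ε (smallSeq k) (damp (smallSeq k) (w x))
    have h2 := softPosDeriv_nonneg ε (smallSeq k) (-damp (smallSeq k) (w x))
    have h3 := softPosDeriv_le_one ε (smallSeq k) (damp (smallSeq k) (w x))
    have h4 := softPosDeriv_le_one ε (smallSeq k) (-damp (smallSeq k) (w x))
    have h5 := dampDeriv_nonneg (smallSeq k) (w x)
    rw [abs_of_nonneg (by positivity)]
    exact (mul_le_of_le_one_right (by linarith) (dampDeriv_le_one _ _)).trans (by linarith)
  · have h1 : Tendsto (fun k => damp (smallSeq k) (w x)) atTop (𝓝 (w x)) :=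
      tendsto_damp smallSeq_pos tendsto_smallSeq tendsto_const_nhds
    rw [cutNearZero_eq hε]
    exact (tendsto_softPos tendsto_smallSeq h1).sub (tendsto_softPos tendsto_smallSeq h1.neg)
  · have h1 : Tendsto (fun k => damp (smallSeq k) (w x)) atTop (𝓝 (w x)) :=
      tendsto_damp smallSeq_pos tendsto_smallSeq tendsto_const_nhds
    have hd : Tendsto (fun k => dampDeriv (smallSeq k) (w x)) atTop (𝓝 1) :=
      tendsto_dampDeriv tendsto_smallSeq tendsto_const_nhds
    suffices hs : Tendsto (fun k => softPosDeriv ε (smallSeq k) (damp (smallSeq k) (w x)) +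
        softPosDeriv ε (smallSeq k) (-damp (smallSeq k) (w x))) atTop
        (𝓝 ({x | ε < |w x|}.indicator 1 x)) by
      have := (hs.mul hd).mul_const (g x)
      simp only [zero_mul, zero_add]
      convert this using 2
      by_cases hx : x ∈ {x | ε < |w x|}
      · simp [indicator_of_mem hx]
      · simp [indicator_of_notMem hx]
    by_cases hx : ε < |w x|
    · rw [indicator_of_mem (show x ∈ {x | ε < |w x|} from hx)]
      rcases le_total 0 (w x) with h0 | h0
      · rw [abs_of_nonneg h0] at hx
        refine (tendsto_softPosDeriv tendsto_smallSeq h1 hx).congr fun k => ?_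
        have := damp_nonneg (smallSeq_pos k) h0
        rw [softPosDeriv_eq_zero (t := -damp _ _) _ (by linarith), add_zero]
      · rw [abs_of_nonpos h0] at hx
        refine (tendsto_softPosDeriv tendsto_smallSeq h1.neg hx).congr fun k => ?_
        have := damp_nonneg (smallSeq_pos k) (neg_nonneg.2 h0)
        rw [damp_neg] at this
        rw [softPosDeriv_eq_zero (t := damp _ _) _ (by linarith), zero_add]
    · rw [indicator_of_notMem (show x ∉ {x | ε < |w x|} from hx)]
      refine tendsto_const_nhds.congr fun k => ?_
      have h0 := (abs_damp_le (smallSeq_pos k) (w x)).trans (not_lt.1 hx)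
      rw [softPosDeriv_eq_zero _ ((le_abs_self _).trans h0),
        softPosDeriv_eq_zero _ ((neg_le_abs _).trans h0), add_zero]

/-! ### Regularized powers: uniform bounds and limits -/

/-- A regularization of `|c|ᵃ c`. -/
noncomputable def regPow (δ a c : ℝ) : ℝ := c * (c ^ 2 + δ ^ 2) ^ (a / 2)

/-- The derivative of `regPow δ a c` with respect to `a`. -/
noncomputable def regPowDerivExp (δ a c : ℝ) : ℝ :=
  c * ((c ^ 2 + δ ^ 2) ^ (a / 2) * (Real.log (c ^ 2 + δ ^ 2) / 2))

/-- The derivative of `regPow δ a c` with respect to `c`. -/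
noncomputable def regPowDeriv (δ a c : ℝ) : ℝ :=
  (c ^ 2 + δ ^ 2) ^ (a / 2) * (1 + a * c ^ 2 / (c ^ 2 + δ ^ 2))

/-- The derivative of `|w|ᵃ w` when `w` and `a` have derivatives `g` and `d`. -/
noncomputable def powDeriv (a d w g : ℝ) : ℝ :=
  |w| ^ a * w * Real.log |w| * d + (1 + a) * |w| ^ a * g

section regPow

variable {δ a c t κ : ℝ}

theorem continuous_regPow (hδ : 0 < δ) : Continuous (Function.uncurry (regPow δ)) := by
  have h : Continuous fun p : ℝ × ℝ => p.2 * (p.2 ^ 2 + δ ^ 2) ^ (p.1 / 2) :=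
    continuous_snd.mul (Continuous.rpow (by fun_prop) (by fun_prop) fun p => Or.inl (by positivity))
  exact h

theorem continuous_regPowDerivExp (hδ : 0 < δ) :
    Continuous (Function.uncurry (regPowDerivExp δ)) := by
  have h : Continuous fun p : ℝ × ℝ =>
      p.2 * ((p.2 ^ 2 + δ ^ 2) ^ (p.1 / 2) * (Real.log (p.2 ^ 2 + δ ^ 2) / 2)) :=
    continuous_snd.mul ((Continuous.rpow (by fun_prop) (by fun_prop)
      fun p => Or.inl (by positivity)).mul
      ((Continuous.log (by fun_prop) fun p => by positivity).div_const 2))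
  exact h

theorem continuous_regPowDeriv (hδ : 0 < δ) :
    Continuous (Function.uncurry (regPowDeriv δ)) := by
  have h : Continuous fun p : ℝ × ℝ =>
      (p.2 ^ 2 + δ ^ 2) ^ (p.1 / 2) * (1 + p.1 * p.2 ^ 2 / (p.2 ^ 2 + δ ^ 2)) :=
    (Continuous.rpow (by fun_prop) (by fun_prop) fun p => Or.inl (by positivity)).mul
      (continuous_const.add (Continuous.div (by fun_prop) (by fun_prop) fun p => by positivity))
  exact h

theorem hasDerivAt_regPow (hδ : 0 < δ) (p q : ℝ → ℝ) (p' q' s : ℝ) (hp : HasDerivAt p p' s)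
    (hq : HasDerivAt q q' s) : HasDerivAt (fun s => regPow δ (p s) (q s))
      (regPowDerivExp δ (p s) (q s) * p' + regPowDeriv δ (p s) (q s) * q') s := by
  have hs : 0 < q s ^ 2 + δ ^ 2 := by positivity
  have h1 := hq.mul (((hq.pow 2).add_const (δ ^ 2)).rpow (hp.div_const 2) hs)
  convert! h1 using 1
  simp only [regPowDerivExp, regPowDeriv, Pi.pow_apply]
  rw [Real.rpow_sub_one hs.ne']
  field_simp
  push_cast
  ring

theorem rpow_half_le_rpow {s U r : ℝ} (hs : 0 ≤ s) (hU : 0 ≤ U) (hsU : s ≤ U ^ 2) (hr : 0 ≤ r) :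
    s ^ (r / 2) ≤ U ^ r := by
  calc s ^ (r / 2) ≤ (U ^ 2) ^ (r / 2) := Real.rpow_le_rpow hs hsU (by positivity)
    _ = U ^ r := by
      rw [← Real.rpow_natCast, ← Real.rpow_mul hU]
      congr 1
      push_cast
      ring

/-- The logarithm satisfies |log s| ≤ (s^κ + s^(-κ))/κ, and κ ≤ q keeps s^(q-κ) bounded near 0. -/
theorem rpow_mul_abs_log_le {s U q : ℝ} (hs : 0 < s) (hsU : s ≤ U) (hU : 1 ≤ U) (hκ : 0 < κ)
    (hκq : κ ≤ q) : s ^ q * |Real.log s| ≤ 2 / κ * U ^ (q + κ) := by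
  have h1 : |Real.log s| ≤ (s ^ κ + s ^ (-κ)) / κ := by
    have e1 := Real.log_le_rpow_div hs.le hκ
    have e2 := Real.log_le_rpow_div (inv_pos.2 hs).le hκ
    rw [Real.log_inv, Real.inv_rpow hs.le, ← Real.rpow_neg hs.le] at e2
    have p1 : 0 ≤ s ^ κ / κ := by positivity
    have p2 : 0 ≤ s ^ (-κ) / κ := by positivity
    rw [add_div]
    exact abs_le.2 ⟨by linarith, by linarith⟩
  have h2 : s ^ (q + κ) ≤ U ^ (q + κ) := Real.rpow_le_rpow hs.le hsU (by linarith)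
  have h3 : s ^ (q - κ) ≤ U ^ (q + κ) :=
    (Real.rpow_le_rpow hs.le hsU (by linarith)).trans
      (Real.rpow_le_rpow_of_exponent_le hU (by linarith))
  calc s ^ q * |Real.log s| ≤ s ^ q * ((s ^ κ + s ^ (-κ)) / κ) :=
        mul_le_mul_of_nonneg_left h1 (by positivity)
    _ = (s ^ (q + κ) + s ^ (q - κ)) / κ := by
        rw [Real.rpow_add hs, Real.rpow_sub hs, Real.rpow_neg hs.le]
        field_simp
    _ ≤ (U ^ (q + κ) + U ^ (q + κ)) / κ := by gcongr
    _ = 2 / κ * U ^ (q + κ) := by ring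

theorem abs_le_rpow_half : |c| ≤ (c ^ 2 + δ ^ 2) ^ (1 / 2 : ℝ) := by
  rw [← Real.sqrt_eq_rpow]
  exact Real.abs_le_sqrt (by nlinarith [sq_nonneg δ])

theorem sq_add_sq_le_one_add_sq (hδ : 0 < δ) (hδ1 : δ ≤ 1) (hct : |c| ≤ |t|) :
    c ^ 2 + δ ^ 2 ≤ (1 + |t|) ^ 2 := by
  have := sq_le_sq.2 hct
  nlinarith [abs_nonneg t, sq_abs t]

theorem abs_regPow_le_rpow (hδ : 0 < δ) :
    |regPow δ a c| ≤ (c ^ 2 + δ ^ 2) ^ ((a + 1) / 2) := by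
  have hs : 0 < c ^ 2 + δ ^ 2 := by positivity
  rw [regPow, abs_mul, abs_of_nonneg (Real.rpow_nonneg hs.le _)]
  calc |c| * (c ^ 2 + δ ^ 2) ^ (a / 2)
      ≤ (c ^ 2 + δ ^ 2) ^ (1 / 2 : ℝ) * (c ^ 2 + δ ^ 2) ^ (a / 2) :=
        mul_le_mul_of_nonneg_right abs_le_rpow_half (by positivity)
    _ = _ := by rw [← Real.rpow_add hs]; congr 1; ring

theorem abs_regPow_le (hδ : 0 < δ) (hδ1 : δ ≤ 1) (hct : |c| ≤ |t|) (ha : 0 ≤ a + 1) :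
    |regPow δ a c| ≤ (1 + |t|) ^ (a + 1) :=
  (abs_regPow_le_rpow hδ).trans
    (rpow_half_le_rpow (by positivity) (by positivity) (sq_add_sq_le_one_add_sq hδ hδ1 hct) ha)

/-- The previous estimate is applied to s = c² + δ² ≤ (1+|t|)² with q = (a+1)/2, so a loss of κ in s
becomes a loss of 2κ in 1 + |t|. -/
theorem abs_regPowDerivExp_le (hδ : 0 < δ) (hδ1 : δ ≤ 1) (hct : |c| ≤ |t|) (hκ : 0 < κ)
    (ha : 2 * κ ≤ a + 1) :
    |regPowDerivExp δ a c| ≤ 1 / κ * (1 + |t|) ^ (a + 1 + 2 * κ) := by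
  have hs : 0 < c ^ 2 + δ ^ 2 := by positivity
  have e : regPowDerivExp δ a c = regPow δ a c * (Real.log (c ^ 2 + δ ^ 2) / 2) := by
    simp only [regPowDerivExp, regPow]; ring
  have hU : (1 : ℝ) ≤ (1 + |t|) ^ 2 := one_le_pow₀ (by linarith [abs_nonneg t])
  have h1 := rpow_mul_abs_log_le (q := (a + 1) / 2) hs (sq_add_sq_le_one_add_sq hδ hδ1 hct) hU hκ
    (by linarith)
  have h2 : ((1 + |t|) ^ 2) ^ ((a + 1) / 2 + κ) = (1 + |t|) ^ (a + 1 + 2 * κ) := by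
    rw [← Real.rpow_natCast, ← Real.rpow_mul (by positivity)]
    congr 1
    push_cast
    ring
  rw [h2] at h1
  rw [e, abs_mul, abs_div, abs_two]
  calc |regPow δ a c| * (|Real.log (c ^ 2 + δ ^ 2)| / 2)
      ≤ (c ^ 2 + δ ^ 2) ^ ((a + 1) / 2) * (|Real.log (c ^ 2 + δ ^ 2)| / 2) :=
        mul_le_mul_of_nonneg_right (abs_regPow_le_rpow hδ) (by positivity)
    _ = (c ^ 2 + δ ^ 2) ^ ((a + 1) / 2) * |Real.log (c ^ 2 + δ ^ 2)| / 2 := by ring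
    _ ≤ 2 / κ * (1 + |t|) ^ (a + 1 + 2 * κ) / 2 := by gcongr
    _ = _ := by ring

theorem sq_div_mem (hδ : 0 < δ) : 0 ≤ c ^ 2 / (c ^ 2 + δ ^ 2) ∧ c ^ 2 / (c ^ 2 + δ ^ 2) ≤ 1 :=
  ⟨by positivity, by rw [div_le_one (by positivity)]; nlinarith [sq_nonneg δ]⟩

theorem regPowDeriv_nonneg (hδ : 0 < δ) (ha : -1 < a) : 0 ≤ regPowDeriv δ a c := by
  obtain ⟨h0, h1⟩ := sq_div_mem (c := c) hδ
  refine mul_nonneg (by positivity) ?_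
  rw [mul_div_assoc]
  nlinarith

/-- The condition δ ≤ |t| gives c² + δ² ≤ (2|t|)², hence a pure multiple of |t|^a. An additive
constant would be useless, since only |u|^a |D_i u| is controlled, not D_i u. -/
theorem regPowDeriv_le_of_nonneg (hδ : 0 < δ) (ha : 0 ≤ a) (hct : |c| ≤ |t|) (hδt : δ ≤ |t|) :
    regPowDeriv δ a c ≤ (1 + a) * 2 ^ a * |t| ^ a := by
  obtain ⟨h0, h1⟩ := sq_div_mem (c := c) hδ
  have h2 : (c ^ 2 + δ ^ 2) ^ (a / 2) ≤ (2 * |t|) ^ a := by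
    refine rpow_half_le_rpow (by positivity) (by positivity) ?_ ha
    have := sq_le_sq.2 hct
    nlinarith [abs_nonneg t, sq_abs t]
  rw [Real.mul_rpow (by norm_num) (abs_nonneg t)] at h2
  have h3 : 1 + a * c ^ 2 / (c ^ 2 + δ ^ 2) ≤ 1 + a := by
    rw [mul_div_assoc]; nlinarith
  calc regPowDeriv δ a c ≤ (2 ^ a * |t| ^ a) * (1 + a) := by
        refine mul_le_mul h2 h3 ?_ (by positivity)
        positivity
    _ = _ := by ring

theorem rpow_half_le_abs_rpow (ha : a ≤ 0) (hc : c ≠ 0) :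
    (c ^ 2 + δ ^ 2) ^ (a / 2) ≤ |c| ^ a := by
  have hc' : 0 < c ^ 2 := by positivity
  calc (c ^ 2 + δ ^ 2) ^ (a / 2) ≤ (c ^ 2) ^ (a / 2) :=
        Real.rpow_le_rpow_of_nonpos hc' (by nlinarith [sq_nonneg δ]) (by linarith)
    _ = |c| ^ a := by
        rw [← sq_abs, ← Real.rpow_natCast, ← Real.rpow_mul (abs_nonneg c)]
        congr 1
        push_cast
        ring

theorem abs_regPow_le_of_nonpos (ha : a ≤ 0) (ha1 : -1 < a) (hct : |c| ≤ |t|) :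
    |regPow δ a c| ≤ |t| ^ (a + 1) := by
  rcases eq_or_ne c 0 with rfl | hc
  · simp only [regPow, zero_mul, abs_zero]; positivity
  rw [regPow, abs_mul, abs_of_nonneg (Real.rpow_nonneg (by positivity) _)]
  calc |c| * (c ^ 2 + δ ^ 2) ^ (a / 2) ≤ |c| * |c| ^ a :=
        mul_le_mul_of_nonneg_left (rpow_half_le_abs_rpow ha hc) (abs_nonneg c)
    _ = |c| ^ (a + 1) := by rw [Real.rpow_add_one (abs_pos.2 hc).ne']; ring
    _ ≤ |t| ^ (a + 1) := Real.rpow_le_rpow (abs_nonneg c) hct (by linarith)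

/-- For negative a the derivative is at most |c|^a, which blows up at 0. As |regPow| ≤ |c|^(a+1), a
value above ε forces |c| ≥ min(1, ε^(1/m)), uniformly in δ, and |c|^a ≤ 1/|c| when |c| ≤ 1. -/
theorem regPowDeriv_le_of_nonpos {ε m : ℝ} (hδ : 0 < δ) (ha : a ≤ 0) (ha1 : -1 < a) (hm : 0 < m)
    (hma : m ≤ a + 1) (hε : 0 < ε) (h : ε < |regPow δ a c|) :
    regPowDeriv δ a c ≤ 1 + (ε ^ (1 / m))⁻¹ := by
  have hc : c ≠ 0 := by
    rintro rfl
    simp only [regPow, zero_mul, abs_zero] at h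
    linarith
  obtain ⟨h0, h1⟩ := sq_div_mem (c := c) hδ
  have h2 : regPowDeriv δ a c ≤ |c| ^ a := by
    refine le_trans (mul_le_of_le_one_right (by positivity) ?_) (rpow_half_le_abs_rpow ha hc)
    rw [mul_div_assoc]
    nlinarith
  refine h2.trans ?_
  have hc0 := abs_pos.2 hc
  have hinv : 0 ≤ (ε ^ (1 / m))⁻¹ := by positivity
  rcases le_total 1 |c| with h3 | h3
  · linarith [Real.rpow_le_one_of_one_le_of_nonpos h3 ha]
  · have h4 : ε ≤ |c| ^ m :=
      (h.le.trans (abs_regPow_le_of_nonpos ha ha1 le_rfl)).trans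
        (Real.rpow_le_rpow_of_exponent_ge hc0 h3 hma)
    have h5 : ε ^ (1 / m) ≤ |c| := by
      calc ε ^ (1 / m) ≤ (|c| ^ m) ^ (1 / m) := Real.rpow_le_rpow hε.le h4 (by positivity)
        _ = |c| := by rw [← Real.rpow_mul hc0.le, mul_one_div_cancel hm.ne', Real.rpow_one]
    have h6 : |c| ^ a ≤ |c|⁻¹ := by
      rw [← Real.rpow_neg_one]
      exact Real.rpow_le_rpow_of_exponent_ge hc0 h3 ha1.le
    have h7 : |c|⁻¹ ≤ (ε ^ (1 / m))⁻¹ := inv_anti₀ (by positivity) h5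
    linarith

end regPow

section limits

variable {δ c : ℕ → ℝ} {a t : ℝ}

theorem sq_rpow_half (a t : ℝ) : (t ^ 2) ^ (a / 2) = |t| ^ a := by
  rw [← sq_abs, ← Real.rpow_natCast, ← Real.rpow_mul (abs_nonneg t)]
  congr 1
  push_cast
  ring

theorem tendsto_sq_add_sq (hδ : Tendsto δ atTop (𝓝 0)) (hc : Tendsto c atTop (𝓝 t)) :
    Tendsto (fun k => c k ^ 2 + δ k ^ 2) atTop (𝓝 (t ^ 2)) := by
  simpa using (hc.pow 2).add (hδ.pow 2)

theorem tendsto_rpow_half (hδ : Tendsto δ atTop (𝓝 0)) (hc : Tendsto c atTop (𝓝 t))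
    (ht : t ≠ 0) : Tendsto (fun k => (c k ^ 2 + δ k ^ 2) ^ (a / 2)) atTop (𝓝 (|t| ^ a)) := by
  rw [← sq_rpow_half]
  exact (tendsto_sq_add_sq hδ hc).rpow_const (Or.inl (by positivity))

theorem tendsto_regPow (hδ : Tendsto δ atTop (𝓝 0)) (hc : Tendsto c atTop (𝓝 t)) (ht : t ≠ 0) :
    Tendsto (fun k => regPow (δ k) a (c k)) atTop (𝓝 (|t| ^ a * t)) := by
  rw [mul_comm]
  exact hc.mul (tendsto_rpow_half hδ hc ht)

theorem tendsto_regPowDerivExp (hδ : Tendsto δ atTop (𝓝 0)) (hc : Tendsto c atTop (𝓝 t))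
    (ht : t ≠ 0) :
    Tendsto (fun k => regPowDerivExp (δ k) a (c k)) atTop (𝓝 (|t| ^ a * t * Real.log |t|)) := by
  have h := hc.mul ((tendsto_rpow_half (a := a) hδ hc ht).mul
    (((tendsto_sq_add_sq hδ hc).log (by positivity)).div_const 2))
  have hv : t * (|t| ^ a * (Real.log (t ^ 2) / 2)) = |t| ^ a * t * Real.log |t| := by
    rw [← sq_abs t, Real.log_pow]
    push_cast
    ring
  rwa [hv] at h

theorem tendsto_regPowDeriv (hδ : Tendsto δ atTop (𝓝 0)) (hc : Tendsto c atTop (𝓝 t))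
    (ht : t ≠ 0) :
    Tendsto (fun k => regPowDeriv (δ k) a (c k)) atTop (𝓝 ((1 + a) * |t| ^ a)) := by
  have h1 := ((hc.pow 2).const_mul a).div (tendsto_sq_add_sq hδ hc) (by positivity)
  have h := (tendsto_rpow_half (a := a) hδ hc ht).mul (h1.const_add 1)
  have hv : |t| ^ a * (1 + a * t ^ 2 / t ^ 2) = (1 + a) * |t| ^ a := by field_simp
  rwa [hv] at h

end limits

/-! ### Chain rules for powers with variable exponent -/

section powers

variable {n : ℕ} {Ω : Set (Eucl n)} {i : Fin n} {a : Eucl n → ℝ}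
  {a' : Eucl n → (Eucl n →L[ℝ] ℝ)} {A κ : ℝ} {H : Eucl n → ℝ}

theorem HasWeakPartial.comp_regPow (hΩ : IsOpen Ω) {w g : Eucl n → ℝ} {δ : ℝ} (hδ : 0 < δ)
    (h : HasWeakPartial Ω i w g) (ha : ∀ x ∈ Ω, HasFDerivAt a (a' x) x)
    (ha' : ContinuousOn a' Ω) (haA : ∀ x ∈ Ω, |a x| ≤ A) :
    HasWeakPartial Ω i (fun x => regPow δ (a x) (damp δ (w x)))
      (fun x => regPowDerivExp δ (a x) (damp δ (w x)) * a' x (EuclideanSpace.single i 1) +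
        regPowDeriv δ (a x) (damp δ (w x)) * dampDeriv δ (w x) * g x) :=
  h.comp_damp hΩ hδ ha ha' haA (continuous_regPow hδ) (continuous_regPowDerivExp hδ)
    (continuous_regPowDeriv hδ) (hasDerivAt_regPow hδ)

theorem abs_clm_single_le (L : Eucl n →L[ℝ] ℝ) (i : Fin n) :
    |L (EuclideanSpace.single i 1)| ≤ ‖L‖ := by
  simpa using L.le_opNorm (EuclideanSpace.single i (1 : ℝ))

/-- Chain rule for `|u|ᵃ u` with a positive exponent `a`. -/
theorem HasWeakPartialOffZero.abs_rpow_mul (hΩ : IsOpen Ω) {u g v : Eucl n → ℝ}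
    (hu : HasWeakPartialOffZero Ω i u g) (ha : ∀ x ∈ Ω, HasFDerivAt a (a' x) x)
    (ha' : ContinuousOn a' Ω) (haA : ∀ x ∈ Ω, |a x| ≤ A) (ha'A : ∀ x ∈ Ω, ‖a' x‖ ≤ A)
    (ha0 : ∀ x ∈ Ω, 0 < a x) (hκ : 0 < κ) (hκ1 : 2 * κ ≤ 1)
    (hH : LocallyIntegrableOn H Ω)
    (hHu : ∀ᵐ x ∂((volume : Measure (Eucl n)).restrict Ω),
      (1 + |u x|) ^ (a x + 1 + 2 * κ) ≤ H x)
    (hg : LocallyIntegrableOn (fun x => |u x| ^ a x * |g x|) Ω)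
    (hv : ∀ᵐ x ∂((volume : Measure (Eucl n)).restrict Ω), v x = |u x| ^ a x * u x) :
    HasWeakPartial Ω i v
      (fun x => powDeriv (a x) (a' x (EuclideanSpace.single i 1)) (u x) (g x)) := by
  -- The same δ_k serves as truncation level and as regularization parameter: the derivative of the
  -- truncation lives on {|u| > δ_k}, exactly where `regPowDeriv_le_of_nonneg` applies.
  have hk : ∀ k, HasWeakPartial Ω i _ _ := fun k =>
    (hu.2 (smallSeq k) (smallSeq_pos k)).comp_regPow hΩ (smallSeq_pos k) ha ha' haA
  have hΩae : ∀ᵐ x ∂((volume : Measure (Eucl n)).restrict Ω), x ∈ Ω :=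
    ae_restrict_mem hΩ.measurableSet
  have hct : ∀ k x, |damp (smallSeq k) (cutNearZero (smallSeq k) (u x))| ≤ |u x| := fun k x =>
    (abs_damp_le (smallSeq_pos k) _).trans (abs_cutNearZero_le (smallSeq_pos k) _)
  have hdamp : ∀ x, Tendsto (fun k => damp (smallSeq k) (cutNearZero (smallSeq k) (u x))) atTop
      (𝓝 (u x)) := fun x => by
    have h1 := tendsto_cutNearZero tendsto_smallSeq (tendsto_const_nhds (x := u x))
    rw [cutNearZero_zero_left] at h1
    exact tendsto_damp smallSeq_pos tendsto_smallSeq h1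
  refine HasWeakPartial.of_tendsto hΩ hk (H := H)
    (G := fun x => A * (1 / κ) * H x + (1 + A) * 2 ^ A * (|u x| ^ a x * |g x|))
    hH ((hH.smul (A * (1 / κ))).add (hg.smul ((1 + A) * 2 ^ A))) ?_ ?_ ?_ ?_
  · filter_upwards [hHu, hΩae] with x hx hxΩ k
    refine (abs_regPow_le (smallSeq_pos k) (smallSeq_le_one k) (hct k x)
      (by linarith [ha0 x hxΩ])).trans (le_trans ?_ hx)
    exact Real.rpow_le_rpow_of_exponent_le (by linarith [abs_nonneg (u x)]) (by linarith)
  · filter_upwards [hHu, hΩae] with x hx hxΩ k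
    have h0 := ha0 x hxΩ
    have hA := (le_abs_self _).trans (haA x hxΩ)
    refine (abs_add_le _ _).trans (add_le_add ?_ ?_)
    · rw [abs_mul]
      have h1 := abs_regPowDerivExp_le (a := a x) (smallSeq_pos k) (smallSeq_le_one k) (hct k x) hκ
        (by linarith)
      have h2 : 1 / κ * (1 + |u x|) ^ (a x + 1 + 2 * κ) ≤ 1 / κ * H x :=
        mul_le_mul_of_nonneg_left hx (by positivity)
      calc _ ≤ (1 / κ * H x) * A :=
            mul_le_mul (h1.trans h2) ((abs_clm_single_le _ _).trans (ha'A x hxΩ)) (abs_nonneg _)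
              ((abs_nonneg _).trans (h1.trans h2))
        _ = _ := by ring
    · by_cases hxk : smallSeq k < |u x|
      · rw [indicator_of_mem (show x ∈ {x | smallSeq k < |u x|} from hxk), abs_mul, abs_mul,
          abs_of_nonneg (dampDeriv_nonneg _ _),
          abs_of_nonneg (regPowDeriv_nonneg (smallSeq_pos k) (by linarith)), ← mul_assoc]
        refine mul_le_mul_of_nonneg_right ?_ (abs_nonneg _)
        refine (mul_le_of_le_one_right (regPowDeriv_nonneg (smallSeq_pos k) (by linarith))
          (dampDeriv_le_one _ _)).trans ?_
        refine (regPowDeriv_le_of_nonneg (smallSeq_pos k) h0.le (hct k x) hxk.le).trans ?_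
        refine mul_le_mul_of_nonneg_right ?_ (by positivity)
        exact mul_le_mul (by linarith) (Real.rpow_le_rpow_of_exponent_le (by norm_num) hA)
          (by positivity) (by linarith)
      · rw [indicator_of_notMem (show x ∉ {x | smallSeq k < |u x|} from hxk), mul_zero, abs_zero]
        have : 0 ≤ A := by linarith
        positivity
  · filter_upwards [hv] with x hx
    rw [hx]
    rcases eq_or_ne (u x) 0 with h0 | h0
    · simp [h0, cutNearZero_zero (smallSeq_pos _), damp_zero, regPow]
    · exact tendsto_regPow tendsto_smallSeq (hdamp x) h0
  · filter_upwards [hΩae] with x hxΩ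
    rcases eq_or_ne (u x) 0 with h0 | h0
    · have : ∀ k, x ∉ {x | smallSeq k < |u x|} := fun k hx => by
        simp only [mem_ofPred_eq, h0, abs_zero] at hx
        exact absurd hx (smallSeq_pos k).le.not_gt
      simp [h0, cutNearZero_zero (smallSeq_pos _), damp_zero, regPowDerivExp, powDeriv,
        indicator_of_notMem (this _), Real.zero_rpow (ha0 x hxΩ).ne']
    · refine ((tendsto_regPowDerivExp tendsto_smallSeq (hdamp x) h0).mul_const _).add ?_
      have hd : Tendsto (fun k => dampDeriv (smallSeq k) (cutNearZero (smallSeq k) (u x))) atTop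
          (𝓝 1) := tendsto_dampDeriv tendsto_smallSeq
            (tendsto_cutNearZero tendsto_smallSeq tendsto_const_nhds)
      have h1 := ((tendsto_regPowDeriv (a := a x) tendsto_smallSeq (hdamp x) h0).mul hd).mul_const
        (g x)
      rw [mul_one] at h1
      refine h1.congr' ?_
      filter_upwards [tendsto_smallSeq.eventually_lt_const (abs_pos.2 h0)] with k hkx
      rw [indicator_of_mem (show x ∈ {x | smallSeq k < |u x|} from hkx)]

/-- Chain rule for `|v|ᵃ v` with an exponent `a` between `-1` and `0`. -/
theorem HasWeakPartial.abs_rpow_mul_offZero (hΩ : IsOpen Ω) {u g v : Eucl n → ℝ} {m : ℝ}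
    (hv : HasWeakPartial Ω i v g) (ha : ∀ x ∈ Ω, HasFDerivAt a (a' x) x)
    (ha' : ContinuousOn a' Ω) (haA : ∀ x ∈ Ω, |a x| ≤ A) (ha'A : ∀ x ∈ Ω, ‖a' x‖ ≤ A)
    (ha0 : ∀ x ∈ Ω, a x ≤ -(2 * κ)) (hκ : 0 < κ) (hm : 0 < m) (hma : ∀ x ∈ Ω, m ≤ a x + 1)
    (hκm : 2 * κ ≤ m)
    (hu : ∀ᵐ x ∂((volume : Measure (Eucl n)).restrict Ω), u x = |v x| ^ a x * v x) :
    HasWeakPartialOffZero Ω i u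
      (fun x => powDeriv (a x) (a' x (EuclideanSpace.single i 1)) (v x) (g x)) := by
  have hΩae : ∀ᵐ x ∂((volume : Measure (Eucl n)).restrict Ω), x ∈ Ω :=
    ae_restrict_mem hΩ.measurableSet
  refine ⟨?_, fun ε hε => ?_⟩
  · have hac : AEMeasurable a (volume.restrict Ω) :=
      ContinuousOn.aemeasurable (fun x hx => (ha x hx).continuousAt.continuousWithinAt)
        hΩ.measurableSet
    have ha'c : AEMeasurable (fun x => a' x (EuclideanSpace.single i 1)) (volume.restrict Ω) :=
      ContinuousOn.aemeasurable (ha'.clm_apply continuousOn_const) hΩ.measurableSet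
    have hvm := hv.1.aestronglyMeasurable.aemeasurable
    have hgm := hv.2.1.aestronglyMeasurable.aemeasurable
    have hva : AEMeasurable (fun x => |v x|) (volume.restrict Ω) := hvm.abs
    have hp := hva.pow hac
    unfold powDeriv
    exact ((((hp.mul hvm).mul hva.log).mul ha'c).add
      (((hac.const_add 1).mul hp).mul hgm)).aestronglyMeasurable
  -- Here the cut comes after the power: it removes the set where the regularized power is at most
  -- ε, and with it the region where its derivative has no uniform bound.
  have hk : ∀ k, HasWeakPartial Ω i _ _ := fun k =>
    (hv.comp_regPow hΩ (smallSeq_pos k) ha ha' haA).cutNearZero hΩ hε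
  have hct : ∀ k x, |damp (smallSeq k) (v x)| ≤ |v x| := fun k x =>
    abs_damp_le (smallSeq_pos k) _
  have hdamp : ∀ x, Tendsto (fun k => damp (smallSeq k) (v x)) atTop (𝓝 (v x)) := fun x =>
    tendsto_damp smallSeq_pos tendsto_smallSeq tendsto_const_nhds
  have hlim : ∀ x ∈ Ω, Tendsto (fun k => regPow (smallSeq k) (a x) (damp (smallSeq k) (v x))) atTop
      (𝓝 (|v x| ^ a x * v x)) := by
    intro x _
    rcases eq_or_ne (v x) 0 with h0 | h0
    · simp [h0, damp_zero, regPow]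
    · exact tendsto_regPow tendsto_smallSeq (hdamp x) h0
  have hH : LocallyIntegrableOn (fun x => 1 + |v x|) Ω :=
    (locallyIntegrableOn_const _).add hv.1.norm
  have hbase : ∀ x, 1 ≤ 1 + |v x| := fun x => by linarith [abs_nonneg (v x)]
  refine HasWeakPartial.of_tendsto hΩ hk (H := fun x => 1 + |v x|)
    (G := fun x => A * (1 / κ) * (1 + |v x|) + (1 + (ε ^ (1 / m))⁻¹) * |g x|)
    hH ((hH.smul (A * (1 / κ))).add (hv.2.1.norm.smul (1 + (ε ^ (1 / m))⁻¹))) ?_ ?_ ?_ ?_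
  · filter_upwards [hΩae] with x hxΩ k
    refine (abs_cutNearZero_le hε _).trans ?_
    refine (abs_regPow_le (smallSeq_pos k) (smallSeq_le_one k) (hct k x)
      (by linarith [hma x hxΩ])).trans ?_
    exact Real.rpow_le_self_of_one_le (hbase x) (by linarith [ha0 x hxΩ])
  · filter_upwards [hΩae] with x hxΩ k
    have hA : 0 ≤ A := (abs_nonneg _).trans (haA x hxΩ)
    have hR : 0 ≤ A * (1 / κ) * (1 + |v x|) := by positivity
    by_cases hxk : ε < |regPow (smallSeq k) (a x) (damp (smallSeq k) (v x))|
    · rw [indicator_of_mem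
        (show x ∈ {x | ε < |regPow (smallSeq k) (a x) (damp (smallSeq k) (v x))|} from hxk)]
      have h0 := ha0 x hxΩ
      have h1 := hma x hxΩ
      refine (abs_add_le _ _).trans (add_le_add ?_ ?_)
      · rw [abs_mul]
        have h2 := abs_regPowDerivExp_le (a := a x) (smallSeq_pos k) (smallSeq_le_one k) (hct k x)
          hκ (by linarith)
        -- The margin a ≤ -2κ keeps the exponent at most 1, so the logarithm costs no more than
        -- local integrability of v.
        have h3 : (1 + |v x|) ^ (a x + 1 + 2 * κ) ≤ 1 + |v x| :=
          Real.rpow_le_self_of_one_le (hbase x) (by linarith)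
        have h4 : 1 / κ * (1 + |v x|) ^ (a x + 1 + 2 * κ) ≤ 1 / κ * (1 + |v x|) :=
          mul_le_mul_of_nonneg_left h3 (by positivity)
        calc _ ≤ (1 / κ * (1 + |v x|)) * A :=
              mul_le_mul (h2.trans h4) ((abs_clm_single_le _ _).trans (ha'A x hxΩ)) (abs_nonneg _)
                ((abs_nonneg _).trans (h2.trans h4))
          _ = _ := by ring
      · rw [abs_mul, abs_mul, abs_of_nonneg (dampDeriv_nonneg _ _),
          abs_of_nonneg (regPowDeriv_nonneg (smallSeq_pos k) (by linarith))]
        refine mul_le_mul_of_nonneg_right ?_ (abs_nonneg _)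
        refine (mul_le_of_le_one_right (regPowDeriv_nonneg (smallSeq_pos k) (by linarith))
          (dampDeriv_le_one _ _)).trans ?_
        exact regPowDeriv_le_of_nonpos (smallSeq_pos k) (by linarith) (by linarith) hm h1 hε hxk
    · rw [indicator_of_notMem
        (show x ∉ {x | ε < |regPow (smallSeq k) (a x) (damp (smallSeq k) (v x))|} from hxk),
        abs_zero]
      positivity
  · filter_upwards [hΩae, hu] with x hxΩ hx
    rw [hx]
    exact tendsto_cutNearZero tendsto_const_nhds (hlim x hxΩ)
  · filter_upwards [hΩae, hu] with x hxΩ hx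
    have h0 := ha0 x hxΩ
    have h1 := hma x hxΩ
    by_cases hxε : ε < |u x|
    · rw [indicator_of_mem (show x ∈ {x | ε < |u x|} from hxε)]
      have hv0 : v x ≠ 0 := by
        intro h
        rw [hx, h, mul_zero, abs_zero] at hxε
        linarith
      rw [hx] at hxε
      have hd : Tendsto (fun k => dampDeriv (smallSeq k) (v x)) atTop (𝓝 1) :=
        tendsto_dampDeriv tendsto_smallSeq tendsto_const_nhds
      have h2 := ((tendsto_regPowDeriv (a := a x) tendsto_smallSeq (hdamp x) hv0).mul hd).mul_const
        (g x)
      rw [mul_one] at h2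
      have h3 := ((tendsto_regPowDerivExp (a := a x) tendsto_smallSeq (hdamp x) hv0).mul_const
        (a' x (EuclideanSpace.single i 1))).add h2
      refine h3.congr' ?_
      filter_upwards [(hlim x hxΩ).abs.eventually_const_lt hxε] with k hkx
      rw [indicator_of_mem
        (show x ∈ {x | ε < |regPow (smallSeq k) (a x) (damp (smallSeq k) (v x))|} from hkx)]
    · rw [indicator_of_notMem (show x ∉ {x | ε < |u x|} from hxε)]
      refine tendsto_const_nhds.congr fun k => ?_
      rw [indicator_of_notMem]
      intro hkx
      -- The regularized power never exceeds |v|^(a+1) = |u|, so where |u| ≤ ε the indicator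
      -- vanishes for every k.
      refine hxε (lt_of_lt_of_le hkx ?_)
      refine (abs_regPow_le_of_nonpos (by linarith) (by linarith) (hct k x)).trans (le_of_eq ?_)
      rw [hx, abs_mul, abs_of_nonneg (Real.rpow_nonneg (abs_nonneg _) _)]
      rcases eq_or_ne (v x) 0 with hv0 | hv0
      · rw [hv0, abs_zero, mul_zero, Real.zero_rpow (by linarith)]
      · rw [Real.rpow_add_one (abs_pos.2 hv0).ne']

end powers

/-! ### Pointwise inequalities for powers and logarithms -/

section pointwise

variable {a b t : ℝ}

theorem abs_abs_rpow_mul_self (ha : a + 1 ≠ 0) (t : ℝ) : |(|t| ^ a * t)| = |t| ^ (a + 1) := by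
  rw [abs_mul, abs_of_nonneg (Real.rpow_nonneg (abs_nonneg t) _)]
  rcases eq_or_ne t 0 with rfl | ht
  · simp [Real.zero_rpow ha]
  · rw [Real.rpow_add_one (abs_pos.2 ht).ne']

theorem abs_rpow_mul_self_inverse (hab : (a + 1) * (b + 1) = 1) (t : ℝ) :
    |(|t| ^ a * t)| ^ b * (|t| ^ a * t) = t := by
  have ha : a + 1 ≠ 0 := left_ne_zero_of_mul_eq_one hab
  rcases eq_or_ne t 0 with rfl | ht
  · simp
  · have h0 := abs_pos.2 ht
    rw [abs_abs_rpow_mul_self ha, ← Real.rpow_mul h0.le, ← mul_assoc, ← Real.rpow_add h0]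
    have : (a + 1) * b + a = 0 := by linarith
    rw [this, Real.rpow_zero, one_mul]

theorem one_add_rpow_le {p P : ℝ} (ht : 0 ≤ t) (hp : 0 ≤ p) (hpP : p ≤ P) :
    (1 + t) ^ p ≤ 2 ^ P * (1 + t ^ p) := by
  have h2 : (2 : ℝ) ^ p ≤ 2 ^ P := Real.rpow_le_rpow_of_exponent_le (by norm_num) hpP
  have htp : 0 ≤ t ^ p := Real.rpow_nonneg ht p
  rcases le_total t 1 with h | h
  · calc (1 + t) ^ p ≤ 2 ^ p := Real.rpow_le_rpow (by linarith) (by linarith) hp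
      _ ≤ 2 ^ P := h2
      _ ≤ 2 ^ P * (1 + t ^ p) := le_mul_of_one_le_right (by positivity) (by linarith)
  · calc (1 + t) ^ p ≤ (2 * t) ^ p := Real.rpow_le_rpow (by linarith) (by linarith) hp
      _ = 2 ^ p * t ^ p := Real.mul_rpow (by norm_num) ht
      _ ≤ 2 ^ P * (1 + t ^ p) := mul_le_mul h2 (by linarith) htp (by positivity)

theorem add_rpow_le_two_rpow_mul {x y p P : ℝ} (hx : 0 ≤ x) (hy : 0 ≤ y) (hp : 0 ≤ p)
    (hpP : p ≤ P) : (x + y) ^ p ≤ 2 ^ P * (x ^ p + y ^ p) := by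
  have h2 : (2 : ℝ) ^ p ≤ 2 ^ P := Real.rpow_le_rpow_of_exponent_le (by norm_num) hpP
  have hxp : 0 ≤ x ^ p := Real.rpow_nonneg hx p
  have hyp : 0 ≤ y ^ p := Real.rpow_nonneg hy p
  rcases le_total x y with h | h
  · calc (x + y) ^ p ≤ (2 * y) ^ p := Real.rpow_le_rpow (by linarith) (by linarith) hp
      _ = 2 ^ p * y ^ p := Real.mul_rpow (by norm_num) hy
      _ ≤ _ := mul_le_mul h2 (by linarith) hyp (by positivity)
  · calc (x + y) ^ p ≤ (2 * x) ^ p := Real.rpow_le_rpow (by linarith) (by linarith) hp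
      _ = 2 ^ p * x ^ p := Real.mul_rpow (by norm_num) hx
      _ ≤ _ := mul_le_mul h2 (by linarith) hxp (by positivity)

/-- The logarithm raises the exponent from pβ to (p+κ)β, which must fit below θ. The added 1 in the
constant makes its base at least 1, so that β may be replaced by its upper bound B. -/
theorem rpow_mul_abs_log_mul_rpow_le {p κ d D β B θ Θ : ℝ} (ht : 0 ≤ t) (hκ : 0 < κ)
    (hκp : κ ≤ p) (hd : 0 ≤ d) (hdD : d ≤ D) (hβ : 0 ≤ β) (hβB : β ≤ B)
    (hθ : (p + κ) * β ≤ θ) (hθΘ : θ ≤ Θ) :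
    (t ^ p * |Real.log t| * d) ^ β ≤ (2 / κ * D + 1) ^ B * (2 ^ Θ * (1 + t ^ θ)) := by
  have h1 : t ^ p * |Real.log t| ≤ 2 / κ * (1 + t) ^ (p + κ) := by
    rcases ht.eq_or_lt with rfl | h
    · simp only [Real.log_zero, abs_zero, mul_zero]
      positivity
    · exact rpow_mul_abs_log_le h (by linarith) (by linarith) hκ hκp
  have hD : 0 ≤ D := hd.trans hdD
  have hθ0 : 0 ≤ θ := le_trans (by have := hκ.trans_le hκp; positivity) hθ
  have h2 : t ^ p * |Real.log t| * d ≤ (2 / κ * D + 1) * (1 + t) ^ (p + κ) := by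
    calc t ^ p * |Real.log t| * d ≤ 2 / κ * (1 + t) ^ (p + κ) * D :=
          mul_le_mul h1 hdD hd (by positivity)
      _ = 2 / κ * D * (1 + t) ^ (p + κ) := by ring
      _ ≤ _ := mul_le_mul_of_nonneg_right (by linarith) (by positivity)
  have hK : (1 : ℝ) ≤ 2 / κ * D + 1 := by
    have : 0 ≤ 2 / κ * D := by positivity
    linarith
  calc (t ^ p * |Real.log t| * d) ^ β
      ≤ ((2 / κ * D + 1) * (1 + t) ^ (p + κ)) ^ β :=
        Real.rpow_le_rpow (by positivity) h2 hβ
    _ = (2 / κ * D + 1) ^ β * (1 + t) ^ ((p + κ) * β) := by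
        rw [Real.mul_rpow (by positivity) (by positivity), ← Real.rpow_mul (by positivity)]
    _ ≤ (2 / κ * D + 1) ^ B * (1 + t) ^ θ := by
        refine mul_le_mul (Real.rpow_le_rpow_of_exponent_le hK hβB)
          (Real.rpow_le_rpow_of_exponent_le (by linarith) hθ) (by positivity) (by positivity)
    _ ≤ _ := mul_le_mul_of_nonneg_left (one_add_rpow_le ht hθ0 hθΘ) (by positivity)

theorem abs_powDeriv_le (ha : 0 < a + 1) (d w g : ℝ) :
    |powDeriv a d w g| ≤ |w| ^ (a + 1) * |Real.log (|w|)| * |d| + (1 + a) * |w| ^ a * |g| := by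
  unfold powDeriv
  refine (abs_add_le _ _).trans (le_of_eq ?_)
  rw [abs_mul, abs_mul, abs_abs_rpow_mul_self ha.ne', abs_mul,
    abs_of_nonneg (a := (1 + a) * |w| ^ a) (mul_nonneg (by linarith) (by positivity))]

/-- The weight |w|^(-a) cancels the singular factor in front of g and reduces |w|^(a+1) to |w|;
moreover 0 < 1 + a < 1. -/
theorem abs_rpow_neg_mul_powDeriv_le (ha : 0 < a + 1) (ha0 : a < 0) (d w g : ℝ) :
    |w| ^ (-a) * |powDeriv a d w g| ≤ |w| ^ (1 : ℝ) * |Real.log (|w|)| * |d| + |g| := by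
  rcases eq_or_ne w 0 with rfl | hw
  · rw [abs_zero, Real.zero_rpow (by linarith), zero_mul]
    positivity
  have hw0 := abs_pos.2 hw
  have e1 : |w| ^ (-a) * |w| ^ (a + 1) = |w| ^ (1 : ℝ) := by
    rw [← Real.rpow_add hw0]; congr 1; ring
  have e2 : |w| ^ (-a) * |w| ^ a = 1 := by
    rw [← Real.rpow_add hw0, neg_add_cancel, Real.rpow_zero]
  calc |w| ^ (-a) * |powDeriv a d w g|
      ≤ |w| ^ (-a) * (|w| ^ (a + 1) * |Real.log (|w|)| * |d| + (1 + a) * |w| ^ a * |g|) :=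
        mul_le_mul_of_nonneg_left (abs_powDeriv_le ha d w g) (by positivity)
    _ = (|w| ^ (-a) * |w| ^ (a + 1)) * |Real.log (|w|)| * |d|
          + (1 + a) * (|w| ^ (-a) * |w| ^ a) * |g| := by ring
    _ ≤ _ := by
      rw [e1, e2, mul_one]
      have : (1 + a) * |g| ≤ |g| := mul_le_of_le_one_left (abs_nonneg g) (by linarith)
      linarith

end pointwise

/-! ### Bounds on the exponents and integrability criteria -/

section coefficients

variable {n : ℕ} {Ω : Set (Eucl n)}

theorem IsC1Closure.exists_bound {p : Eucl n → ℝ} (hp : IsC1Closure Ω p)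
    (hΩb : Bornology.IsBounded Ω) :
    ∃ p' : Eucl n → (Eucl n →L[ℝ] ℝ), ∃ C : ℝ, (∀ x ∈ Ω, HasFDerivAt p (p' x) x) ∧
      ContinuousOn p' Ω ∧ (∀ x ∈ Ω, |p x| ≤ C) ∧ ∀ x ∈ Ω, ‖p' x‖ ≤ C := by
  obtain ⟨hpc, p', hp'c, hd⟩ := hp
  have hK : IsCompact (closure Ω) := hΩb.isCompact_closure
  obtain ⟨C₁, h₁⟩ := hK.exists_bound_of_continuousOn hpc
  obtain ⟨C₂, h₂⟩ := hK.exists_bound_of_continuousOn hp'c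
  exact ⟨p', max C₁ C₂, hd, hp'c.mono subset_closure,
    fun x hx => (h₁ x (subset_closure hx)).trans (le_max_left _ _),
    fun x hx => (h₂ x (subset_closure hx)).trans (le_max_right _ _)⟩

/-- As q ≥ 1, the quotient rule gives the bound C·C from p q'/q² and C from p'/q. -/
theorem exists_bound_div {p q : Eucl n → ℝ} {p' q' : Eucl n → (Eucl n →L[ℝ] ℝ)} {C : ℝ}
    (hC : 0 ≤ C)
    (hp : ∀ x ∈ Ω, HasFDerivAt p (p' x) x) (hp' : ContinuousOn p' Ω)
    (hpC : ∀ x ∈ Ω, |p x| ≤ C) (hp'C : ∀ x ∈ Ω, ‖p' x‖ ≤ C)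
    (hq : ∀ x ∈ Ω, HasFDerivAt q (q' x) x) (hq' : ContinuousOn q' Ω)
    (hq'C : ∀ x ∈ Ω, ‖q' x‖ ≤ C) (hq1 : ∀ x ∈ Ω, 1 ≤ q x) :
    ∃ r' : Eucl n → (Eucl n →L[ℝ] ℝ), (∀ x ∈ Ω, HasFDerivAt (fun x => p x / q x) (r' x) x) ∧
      ContinuousOn r' Ω ∧ (∀ x ∈ Ω, |p x / q x| ≤ C * C + C) ∧ ∀ x ∈ Ω, ‖r' x‖ ≤ C * C + C := by
  have hpc : ContinuousOn p Ω := fun x hx => (hp x hx).continuousAt.continuousWithinAt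
  have hqc : ContinuousOn q Ω := fun x hx => (hq x hx).continuousAt.continuousWithinAt
  have hq0 : ∀ x ∈ Ω, q x ≠ 0 := fun x hx => by linarith [hq1 x hx]
  refine ⟨fun x => p x • (-(q x ^ 2)⁻¹ • q' x) + (q x)⁻¹ • p' x, fun x hx => ?_, ?_,
    fun x hx => ?_, fun x hx => ?_⟩
  · have h1 : HasFDerivAt (fun x => (q x)⁻¹) (-(q x ^ 2)⁻¹ • q' x) x :=
      (hasDerivAt_inv (hq0 x hx)).comp_hasFDerivAt x (hq x hx)
    simp only [div_eq_mul_inv]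
    exact (hp x hx).mul h1
  · exact (hpc.smul ((((hqc.pow 2).inv₀ fun x hx => pow_ne_zero 2 (hq0 x hx)).neg).smul hq')).add
      ((hqc.inv₀ hq0).smul hp')
  · rw [abs_div, abs_of_pos (by linarith [hq1 x hx] : 0 < q x)]
    have := div_le_self (abs_nonneg (p x)) (hq1 x hx)
    nlinarith [hpC x hx]
  · have hi : (q x)⁻¹ ≤ 1 := inv_le_one_of_one_le₀ (hq1 x hx)
    have hi0 : 0 ≤ (q x)⁻¹ := inv_nonneg.2 (by linarith [hq1 x hx])
    have hi2 : (q x ^ 2)⁻¹ ≤ 1 := inv_le_one_of_one_le₀ (one_le_pow₀ (hq1 x hx))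
    have hi20 : 0 ≤ (q x ^ 2)⁻¹ := by positivity
    refine (norm_add_le _ _).trans (add_le_add ?_ ?_)
    · rw [norm_smul, norm_smul, norm_neg, Real.norm_eq_abs, Real.norm_eq_abs,
        abs_of_nonneg hi20]
      refine mul_le_mul (hpC x hx) ?_ (by positivity) hC
      exact (mul_le_of_le_one_left (norm_nonneg _) hi2).trans (hq'C x hx)
    · rw [norm_smul, Real.norm_eq_abs, abs_of_nonneg hi0]
      exact (mul_le_of_le_one_left (norm_nonneg _) hi).trans (hp'C x hx)

end coefficients

section integrability

variable {α : Type*} [MeasurableSpace α] {μ : Measure α}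

theorem integrable_of_lintegral_ofReal_lt_top {f : α → ℝ} (hf : AEMeasurable f μ)
    (hf0 : ∀ x, 0 ≤ f x) (h : ∫⁻ x, ENNReal.ofReal (f x) ∂μ < ⊤) : Integrable f μ :=
  (lintegral_ofReal_ne_top_iff_integrable hf.aestronglyMeasurable
    (Eventually.of_forall hf0)).1 h.ne

theorem lintegral_ofReal_lt_top_of_le {f F : α → ℝ} (hF : Integrable F μ)
    (h : ∀ᵐ x ∂μ, f x ≤ F x) : ∫⁻ x, ENNReal.ofReal (f x) ∂μ < ⊤ :=
  (lintegral_mono_ae (h.mono fun _ hx => ENNReal.ofReal_le_ofReal hx)).trans_lt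
    hF.lintegral_lt_top

end integrability

/-! ### The two inclusions -/

section mapping

variable {n : ℕ} {Ω : Set (Eucl n)} {γ β θ : Eucl n → ℝ} {γ' β' : Eucl n → (Eucl n →L[ℝ] ℝ)}
  {C Θ ε₀ : ℝ}

theorem mem_L1Var_inter_LVar (hΩ : IsOpen Ω) (hΩb : Bornology.IsBounded Ω) (hC1 : 1 ≤ C)
    (hγd : ∀ x ∈ Ω, HasFDerivAt γ (γ' x) x) (hγ'c : ContinuousOn γ' Ω)
    (hγC : ∀ x ∈ Ω, |γ x| ≤ C) (hγ'C : ∀ x ∈ Ω, ‖γ' x‖ ≤ C)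
    (hβd : ∀ x ∈ Ω, HasFDerivAt β (β' x) x) (hβ'c : ContinuousOn β' Ω)
    (hβC : ∀ x ∈ Ω, |β x| ≤ C) (hβ'C : ∀ x ∈ Ω, ‖β' x‖ ≤ C)
    (hγ1 : ∀ x ∈ Ω, 1 ≤ γ x) (hβ1 : ∀ x ∈ Ω, 1 ≤ β x)
    (hθm : AEMeasurable θ ((volume : Measure (Eucl n)).restrict Ω))
    (hθΘ : ∀ᵐ x ∂((volume : Measure (Eucl n)).restrict Ω), 1 ≤ θ x ∧ θ x ≤ Θ) (hε₀ : 0 < ε₀)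
    (hθγβ : ∀ᵐ x ∂((volume : Measure (Eucl n)).restrict Ω), γ x + β x + ε₀ ≤ θ x)
    {u v : FunOn Ω} (hu : u ∈ S1Theta Ω γ β θ)
    (hv : ∀ᵐ x ∂((volume : Measure (Eucl n)).restrict Ω), v x = |u x| ^ (γ x / β x) * u x) :
    v ∈ L1Var Ω β ∩ LVar Ω (fun x => θ x * β x / (γ x + β x)) := by
  obtain ⟨⟨-, Du, hDu, hfin⟩, huθ⟩ := hu
  have hfinite : IsFiniteMeasure ((volume : Measure (Eucl n)).restrict Ω) :=
    isFiniteMeasure_restrict.2 hΩb.measure_lt_top.ne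
  have hΩae : ∀ᵐ x ∂((volume : Measure (Eucl n)).restrict Ω), x ∈ Ω :=
    ae_restrict_mem hΩ.measurableSet
  have hγm : AEMeasurable γ ((volume : Measure (Eucl n)).restrict Ω) :=
    ContinuousOn.aemeasurable (fun x hx => (hγd x hx).continuousAt.continuousWithinAt)
      hΩ.measurableSet
  have hβm : AEMeasurable β ((volume : Measure (Eucl n)).restrict Ω) :=
    ContinuousOn.aemeasurable (fun x hx => (hβd x hx).continuousAt.continuousWithinAt)
      hΩ.measurableSet
  have hum : AEMeasurable u ((volume : Measure (Eucl n)).restrict Ω) :=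
    u.aestronglyMeasurable.aemeasurable
  have hvm : AEMeasurable v ((volume : Measure (Eucl n)).restrict Ω) :=
    v.aestronglyMeasurable.aemeasurable
  have huam : AEMeasurable (fun x => |u x|) ((volume : Measure (Eucl n)).restrict Ω) := hum.abs
  obtain ⟨a', had, ha'c, haA, ha'A⟩ := exists_bound_div (by linarith) hγd hγ'c hγC hγ'C hβd hβ'c
    hβ'C hβ1
  set A := C * C + C with hA
  have hA0 : 0 ≤ A := by positivity
  set a : Eucl n → ℝ := fun x => γ x / β x with ha
  have ha0 : ∀ x ∈ Ω, 0 < a x := fun x hx =>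
    div_pos (by linarith [hγ1 x hx]) (by linarith [hβ1 x hx])
  have haβ : ∀ x ∈ Ω, a x * β x = γ x := fun x hx =>
    div_mul_cancel₀ _ (by linarith [hβ1 x hx])
  have haγ : ∀ x ∈ Ω, a x ≤ γ x := fun x hx => div_le_self (by linarith [hγ1 x hx]) (hβ1 x hx)
  have hvabs : ∀ᵐ x ∂((volume : Measure (Eucl n)).restrict Ω), |v x| = |u x| ^ (a x + 1) := by
    filter_upwards [hv, hΩae] with x hx hxΩ
    rw [hx, abs_abs_rpow_mul_self (by linarith [ha0 x hxΩ])]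
  -- Dividing by C gives κβ ≤ ε₀, so the logarithmic term fits below θ. As C ≥ 1, also 2κ ≤ 1 and 2κ
  -- ≤ ε₀, as the chain rule and its majorant H require.
  set κ := min 1 ε₀ / (4 * C) with hκd
  have hmin := lt_min one_pos hε₀
  have hκ : 0 < κ := by positivity
  have hκC : 4 * κ * C = min 1 ε₀ := by rw [hκd]; field_simp
  have hκmin : 4 * κ ≤ min 1 ε₀ := hκC ▸ le_mul_of_one_le_right (by positivity) hC1
  have hκ1 : 4 * κ ≤ 1 := hκmin.trans (min_le_left _ _)
  have hκε : 4 * κ ≤ ε₀ := hκmin.trans (min_le_right _ _)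
  have hIθ : Integrable (fun x => |u x| ^ θ x) ((volume : Measure (Eucl n)).restrict Ω) :=
    integrable_of_lintegral_ofReal_lt_top (huam.pow hθm)
      (fun x => Real.rpow_nonneg (abs_nonneg _) _) huθ
  set H : Eucl n → ℝ := fun x => 2 ^ Θ * (1 + |u x| ^ θ x) with hHd
  have hHI : Integrable H ((volume : Measure (Eucl n)).restrict Ω) :=
    ((integrable_const _).add hIθ).const_mul _
  have hHu : ∀ᵐ x ∂((volume : Measure (Eucl n)).restrict Ω),
      (1 + |u x|) ^ (a x + 1 + 2 * κ) ≤ H x := by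
    filter_upwards [hΩae, hθΘ, hθγβ] with x hxΩ hθ h
    refine (Real.rpow_le_rpow_of_exponent_le (by linarith [abs_nonneg (u x)]) ?_).trans
      (one_add_rpow_le (abs_nonneg _) (by linarith) hθ.2)
    linarith [haγ x hxΩ, hβ1 x hxΩ]
  have hγDu : ∀ i, ∫⁻ x in Ω, ENNReal.ofReal (|u x| ^ γ x * |Du i x| ^ β x) < ⊤ := fun i =>
    ENNReal.sum_lt_top.1 (ENNReal.add_lt_top.1 hfin).2 i (Finset.mem_univ i)
  have hγDuI : ∀ i, Integrable (fun x => |u x| ^ γ x * |Du i x| ^ β x)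
      ((volume : Measure (Eucl n)).restrict Ω) := fun i =>
    integrable_of_lintegral_ofReal_lt_top
      ((huam.pow hγm).mul ((hDu i).1.aemeasurable.abs.pow hβm))
      (fun x => by positivity) (hγDu i)
  have hpow : ∀ x ∈ Ω, ∀ s r : ℝ, 0 ≤ s → 0 ≤ r → (s ^ a x * r) ^ β x = s ^ γ x * r ^ β x := by
    intro x hx s r hs hr
    rw [Real.mul_rpow (by positivity) hr, ← Real.rpow_mul hs, haβ x hx]
  refine ⟨⟨?_, fun i => ?_⟩, ?_⟩
  · refine hHI.mono' v.aestronglyMeasurable ?_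
    filter_upwards [hvabs, hHu, hΩae] with x hx hH hxΩ
    rw [Real.norm_eq_abs, hx]
    refine le_trans ?_ hH
    exact (Real.rpow_le_rpow (abs_nonneg _) (by linarith) (by linarith [ha0 x hxΩ])).trans
      (Real.rpow_le_rpow_of_exponent_le (by linarith [abs_nonneg (u x)]) (by linarith))
  · refine ⟨_, (hDu i).abs_rpow_mul hΩ had ha'c haA ha'A ha0 hκ (by linarith)
      (IntegrableOn.locallyIntegrableOn hHI) hHu
      (IntegrableOn.locallyIntegrableOn (μ := volume) ?_) hv, ?_⟩
    · refine Integrable.mono' (μ := (volume : Measure (Eucl n)).restrict Ω)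
        ((integrable_const (1 : ℝ)).add (hγDuI i))
        ((huam.pow (hγm.div hβm)).mul (hDu i).1.aemeasurable.abs).aestronglyMeasurable ?_
      filter_upwards [hΩae] with x hxΩ
      have h0 : 0 ≤ |u x| ^ a x * |Du i x| := by positivity
      show ‖|u x| ^ a x * |Du i x|‖ ≤ 1 + |u x| ^ γ x * |Du i x| ^ β x
      rw [Real.norm_eq_abs, abs_of_nonneg h0, ← hpow x hxΩ _ _ (abs_nonneg _) (abs_nonneg _)]
      -- Since β ≥ 1, y ≤ 1 + y^β, and the β-th power of |u|^a |D_i u| is the integrable function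
      -- |u|^γ |D_i u|^β.
      rcases le_total (|u x| ^ a x * |Du i x|) 1 with h | h
      · linarith [Real.rpow_nonneg h0 (β x)]
      · linarith [Real.self_le_rpow_of_one_le h (hβ1 x hxΩ)]
    · refine lintegral_ofReal_lt_top_of_le
        (((hHI.const_mul ((2 / κ * A + 1) ^ C)).add ((hγDuI i).const_mul ((1 + A) ^ C))).const_mul
          (2 ^ C)) ?_
      filter_upwards [hΩae, hθΘ, hθγβ] with x hxΩ hθ h
      have hβ0 := hβ1 x hxΩ
      have hβle : β x ≤ C := (le_abs_self _).trans (hβC x hxΩ)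
      have ha1 : 0 < a x + 1 := by linarith [ha0 x hxΩ]
      have haA' : a x ≤ A := (le_abs_self _).trans (haA x hxΩ)
      refine (Real.rpow_le_rpow (abs_nonneg _) (abs_powDeriv_le ha1 _ _ _) (by linarith)).trans ?_
      refine (add_rpow_le_two_rpow_mul (by positivity) ?_ (by linarith) hβle).trans ?_
      · exact mul_nonneg (mul_nonneg (by linarith) (by positivity)) (abs_nonneg _)
      refine mul_le_mul_of_nonneg_left (add_le_add ?_ ?_) (by positivity)
      · refine rpow_mul_abs_log_mul_rpow_le (abs_nonneg _) hκ (by linarith [ha0 x hxΩ])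
          (abs_nonneg _) ((abs_clm_single_le _ _).trans (ha'A x hxΩ)) (by linarith) hβle ?_ hθ.2
        have e : (a x + 1 + κ) * β x = γ x + β x + κ * β x := by
          rw [add_mul, add_mul, haβ x hxΩ, one_mul]
        have e2 : κ * β x ≤ κ * C := mul_le_mul_of_nonneg_left hβle hκ.le
        linarith [min_le_right 1 ε₀]
      · rw [mul_assoc, Real.mul_rpow (by linarith) (by positivity),
          hpow x hxΩ _ _ (abs_nonneg _) (abs_nonneg _)]
        refine mul_le_mul_of_nonneg_right ?_ (by positivity)
        exact (Real.rpow_le_rpow (by linarith) (by linarith) (by linarith)).trans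
          (Real.rpow_le_rpow_of_exponent_le (by linarith) hβle)
  · refine lintegral_ofReal_lt_top_of_le hIθ ?_
    filter_upwards [hvabs, hΩae] with x hx hxΩ
    rw [hx, ← Real.rpow_mul (abs_nonneg _)]
    refine le_of_eq ?_
    congr 1
    have h1 := hβ1 x hxΩ
    have h2 := hγ1 x hxΩ
    have h3 : γ x + β x ≠ 0 := by linarith
    have h4 : β x ≠ 0 := by linarith
    simp only [ha]
    field_simp

theorem mem_S1Theta (hΩ : IsOpen Ω) (hΩb : Bornology.IsBounded Ω) (hC1 : 1 ≤ C)
    (hγd : ∀ x ∈ Ω, HasFDerivAt γ (γ' x) x) (hγ'c : ContinuousOn γ' Ω)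
    (hγC : ∀ x ∈ Ω, |γ x| ≤ C) (hγ'C : ∀ x ∈ Ω, ‖γ' x‖ ≤ C)
    (hβd : ∀ x ∈ Ω, HasFDerivAt β (β' x) x) (hβ'c : ContinuousOn β' Ω)
    (hβC : ∀ x ∈ Ω, |β x| ≤ C) (hβ'C : ∀ x ∈ Ω, ‖β' x‖ ≤ C)
    (hγ1 : ∀ x ∈ Ω, 1 ≤ γ x) (hβ1 : ∀ x ∈ Ω, 1 ≤ β x)
    (hθm : AEMeasurable θ ((volume : Measure (Eucl n)).restrict Ω))
    (hθΘ : ∀ᵐ x ∂((volume : Measure (Eucl n)).restrict Ω), 1 ≤ θ x ∧ θ x ≤ Θ) (hε₀ : 0 < ε₀)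
    (hθγβ : ∀ᵐ x ∂((volume : Measure (Eucl n)).restrict Ω), γ x + β x + ε₀ ≤ θ x)
    {u v : FunOn Ω} (hv : v ∈ L1Var Ω β ∩ LVar Ω (fun x => θ x * β x / (γ x + β x)))
    (hu : ∀ᵐ x ∂((volume : Measure (Eucl n)).restrict Ω),
      u x = |v x| ^ (-γ x / (γ x + β x)) * v x) :
    u ∈ S1Theta Ω γ β θ := by
  obtain ⟨⟨hvI, hD⟩, hvψ⟩ := hv
  choose g hg hgfin using hD
  have hfinite : IsFiniteMeasure ((volume : Measure (Eucl n)).restrict Ω) :=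
    isFiniteMeasure_restrict.2 hΩb.measure_lt_top.ne
  have hΩae : ∀ᵐ x ∂((volume : Measure (Eucl n)).restrict Ω), x ∈ Ω :=
    ae_restrict_mem hΩ.measurableSet
  have hγm : AEMeasurable γ ((volume : Measure (Eucl n)).restrict Ω) :=
    ContinuousOn.aemeasurable (fun x hx => (hγd x hx).continuousAt.continuousWithinAt)
      hΩ.measurableSet
  have hβm : AEMeasurable β ((volume : Measure (Eucl n)).restrict Ω) :=
    ContinuousOn.aemeasurable (fun x hx => (hβd x hx).continuousAt.continuousWithinAt)
      hΩ.measurableSet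
  have hvam : AEMeasurable (fun x => |v x|) ((volume : Measure (Eucl n)).restrict Ω) :=
    v.aestronglyMeasurable.aemeasurable.abs
  have hC2 : (0 : ℝ) ≤ 2 * C := by linarith
  have hle : ∀ {y : ℝ}, y ≤ C → y ≤ 2 * C := fun h => by linarith
  obtain ⟨b', hbd, hb'c, hbA, hb'A⟩ := exists_bound_div (p := fun x => -γ x)
    (p' := fun x => -γ' x) (q := fun x => γ x + β x) (q' := fun x => γ' x + β' x) hC2
    (fun x hx => (hγd x hx).neg) hγ'c.neg (fun x hx => by rw [abs_neg]; exact hle (hγC x hx))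
    (fun x hx => by rw [norm_neg]; exact hle (hγ'C x hx))
    (fun x hx => (hγd x hx).add (hβd x hx)) (hγ'c.add hβ'c)
    (fun x hx => (norm_add_le _ _).trans (by linarith [hγ'C x hx, hβ'C x hx]))
    (fun x hx => by linarith [hγ1 x hx, hβ1 x hx])
  set A := 2 * C * (2 * C) + 2 * C with hA
  have hA0 : 0 ≤ A := by positivity
  set b : Eucl n → ℝ := fun x => -γ x / (γ x + β x) with hb
  have hs : ∀ x ∈ Ω, 0 < γ x + β x := fun x hx => by linarith [hγ1 x hx, hβ1 x hx]
  have hsC : ∀ x ∈ Ω, γ x + β x ≤ 2 * C := fun x hx => by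
    linarith [(le_abs_self _).trans (hγC x hx), (le_abs_self _).trans (hβC x hx)]
  have hb1 : ∀ x ∈ Ω, b x + 1 = β x / (γ x + β x) := fun x hx => by
    have := (hs x hx).ne'
    simp only [hb]
    field_simp
    ring
  -- As γ+β ≤ 2C while γ, β ≥ 1, m is a lower bound both for b + 1 = β/(γ+β) and for -b = γ/(γ+β).
  set m := 1 / (2 * C) with hm
  have hm0 : 0 < m := by positivity
  have hfrac : ∀ x ∈ Ω, ∀ y : ℝ, 1 ≤ y → m ≤ y / (γ x + β x) := fun x hx y hy =>
    div_le_div₀ (by linarith) hy (hs x hx) (hsC x hx)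
  have hmb : ∀ x ∈ Ω, m ≤ b x + 1 := fun x hx => by
    rw [hb1 x hx]; exact hfrac x hx _ (hβ1 x hx)
  have hbm : ∀ x ∈ Ω, b x ≤ -m := fun x hx => by
    have := hfrac x hx _ (hγ1 x hx)
    simp only [hb, neg_div]
    linarith
  -- This ensures 2κ ≤ m ≤ -b for the chain rule, and κ ≤ ε₀ m for (1+κ)β ≤ ψ, because ψ - β ≥ ε₀
  -- β/(γ+β) ≥ ε₀ m β.
  set κ := min 1 ε₀ * m / 2 with hκd
  have hmin := lt_min one_pos hε₀
  have hκ : 0 < κ := by positivity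
  have hκm : 2 * κ ≤ m := by
    have : min 1 ε₀ * m ≤ m := mul_le_of_le_one_left hm0.le (min_le_left 1 ε₀)
    linarith
  have hκε : κ ≤ ε₀ * m := by
    have : min 1 ε₀ * m ≤ ε₀ * m := mul_le_mul_of_nonneg_right (min_le_right 1 ε₀) hm0.le
    linarith [hκ]
  have hm1 : m ≤ 1 := by
    rw [hm, div_le_one (by linarith)]; linarith
  have huabs : ∀ᵐ x ∂((volume : Measure (Eucl n)).restrict Ω), |u x| = |v x| ^ (b x + 1) := by
    filter_upwards [hu, hΩae] with x hx hxΩ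
    rw [hx, abs_abs_rpow_mul_self (by linarith [hmb x hxΩ])]
  set ψ : Eucl n → ℝ := fun x => θ x * β x / (γ x + β x) with hψ
  have hψm : AEMeasurable ψ ((volume : Measure (Eucl n)).restrict Ω) :=
    (hθm.mul hβm).div (hγm.add hβm)
  have hIψ : Integrable (fun x => |v x| ^ ψ x) ((volume : Measure (Eucl n)).restrict Ω) :=
    integrable_of_lintegral_ofReal_lt_top (hvam.pow hψm)
      (fun x => Real.rpow_nonneg (abs_nonneg _) _) hvψ
  have hψb : ∀ x ∈ Ω, (b x + 1) * θ x = ψ x := fun x hx => by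
    rw [hb1 x hx]; simp only [hψ]; ring
  have hbβ : ∀ x ∈ Ω, (b x + 1) * (γ x + β x) = β x := fun x hx => by
    rw [hb1 x hx, div_mul_cancel₀ _ (hs x hx).ne']
  have hbγ : ∀ x ∈ Ω, (b x + 1) * γ x = -b x * β x := fun x hx => by
    linarith [hbβ x hx]
  have hψβ : ∀ᵐ x ∂((volume : Measure (Eucl n)).restrict Ω), (1 + κ) * β x ≤ ψ x := by
    filter_upwards [hθγβ, hΩae] with x hx hxΩ
    have h1 : (b x + 1) * (γ x + β x + ε₀) ≤ ψ x := by
      rw [← hψb x hxΩ]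
      exact mul_le_mul_of_nonneg_left hx (by linarith [hmb x hxΩ])
    have h2 : β x * m ≤ b x + 1 := by
      rw [hb1 x hxΩ, ← mul_one_div (β x)]
      exact mul_le_mul_of_nonneg_left (hfrac x hxΩ 1 le_rfl) (by linarith [hβ1 x hxΩ])
    have h3 : β x * m * ε₀ ≤ (b x + 1) * ε₀ := mul_le_mul_of_nonneg_right h2 hε₀.le
    have h4 : κ * β x ≤ ε₀ * m * β x :=
      mul_le_mul_of_nonneg_right hκε (by linarith [hβ1 x hxΩ])
    linarith [hbβ x hxΩ]
  have hψΘ : ∀ᵐ x ∂((volume : Measure (Eucl n)).restrict Ω), ψ x ≤ Θ := by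
    filter_upwards [hθΘ, hΩae] with x hx hxΩ
    rw [← hψb x hxΩ]
    exact (mul_le_of_le_one_left (by linarith) (by linarith [hbm x hxΩ])).trans hx.2
  have hgI : ∀ i, Integrable (fun x => |g i x| ^ β x) ((volume : Measure (Eucl n)).restrict Ω) :=
    fun i => integrable_of_lintegral_ofReal_lt_top
      ((hg i).2.1.aestronglyMeasurable.aemeasurable.abs.pow hβm)
      (fun x => Real.rpow_nonneg (abs_nonneg _) _) (hgfin i)
  set H : Eucl n → ℝ := fun x => 2 ^ Θ * (1 + |v x| ^ ψ x) with hHd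
  have hHI : Integrable H ((volume : Measure (Eucl n)).restrict Ω) :=
    ((integrable_const _).add hIψ).const_mul _
  refine ⟨⟨?_, fun i x => powDeriv (b x) (b' x (EuclideanSpace.single i 1)) (v x) (g i x),
    fun i => (hg i).abs_rpow_mul_offZero hΩ hbd hb'c hbA hb'A
      (fun x hx => by linarith [hbm x hx]) hκ hm0 hmb hκm hu, ?_⟩, ?_⟩
  · refine ((integrable_const (1 : ℝ)).add hvI.abs).mono' u.aestronglyMeasurable ?_
    filter_upwards [huabs, hΩae] with x hx hxΩ
    rw [Real.norm_eq_abs, hx]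
    have h1 := hmb x hxΩ
    have h2 := hbm x hxΩ
    have h0 := abs_nonneg (v x)
    show _ ≤ 1 + |v x|
    exact (Real.rpow_le_rpow h0 (by linarith) (by linarith)).trans
      (Real.rpow_le_self_of_one_le (by linarith) (by linarith))
  · refine ENNReal.add_lt_top.2 ⟨?_, ENNReal.sum_lt_top.2 fun i _ => ?_⟩
    · refine lintegral_ofReal_lt_top_of_le hHI ?_
      filter_upwards [huabs, hΩae, hψβ, hψΘ] with x hx hxΩ h1 h2
      have hβ0 := hβ1 x hxΩ
      have h3 : β x ≤ ψ x := le_trans (by nlinarith) h1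
      rw [hx, ← Real.rpow_mul (abs_nonneg _), hbβ x hxΩ]
      exact (Real.rpow_le_rpow (abs_nonneg _) (by linarith) (by linarith)).trans
        ((Real.rpow_le_rpow_of_exponent_le (by linarith [abs_nonneg (v x)]) h3).trans
          (one_add_rpow_le (abs_nonneg _) (by linarith) h2))
    · refine lintegral_ofReal_lt_top_of_le
        (((hHI.const_mul ((2 / κ * A + 1) ^ C)).add (hgI i)).const_mul (2 ^ C)) ?_
      filter_upwards [huabs, hΩae, hψβ, hψΘ] with x hx hxΩ h1 h2
      have hβ0 := hβ1 x hxΩ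
      have hβle : β x ≤ C := (le_abs_self _).trans (hβC x hxΩ)
      have hb1 := hmb x hxΩ
      have hb2 := hbm x hxΩ
      -- Since (b+1)γ = -bβ, the integrand |u|^γ |D_i u|^β is the β-th power of |v|^(-b) |D_i u|.
      rw [hx, ← Real.rpow_mul (abs_nonneg _), hbγ x hxΩ, Real.rpow_mul (abs_nonneg _),
        ← Real.mul_rpow (by positivity) (abs_nonneg _)]
      refine (Real.rpow_le_rpow (by positivity)
        (abs_rpow_neg_mul_powDeriv_le (by linarith) (by linarith) _ _ _) (by linarith)).trans ?_
      refine (add_rpow_le_two_rpow_mul (by positivity) (abs_nonneg _) (by linarith) hβle).trans ?_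
      refine mul_le_mul_of_nonneg_left (add_le_add ?_ le_rfl) (by positivity)
      exact rpow_mul_abs_log_mul_rpow_le (abs_nonneg _) hκ (by linarith)
          (abs_nonneg _) ((abs_clm_single_le _ _).trans (hb'A x hxΩ)) (by linarith) hβle h1 h2
  · refine lintegral_ofReal_lt_top_of_le hIψ ?_
    filter_upwards [huabs, hΩae] with x hx hxΩ
    rw [hx, ← Real.rpow_mul (abs_nonneg _), hψb x hxΩ]

end mapping

/-! ### The bijection -/

theorem theorem3p8 {n : ℕ} (Ω : Set (Eucl n)) (hΩ : IsOpen Ω) (hΩb : Bornology.IsBounded Ω)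
    (γ β θ : Eucl n → ℝ) (hγ : IsC1Closure Ω γ) (hβ : IsC1Closure Ω β)
    (hγ1 : ∀ x ∈ Ω, 1 ≤ γ x) (hβ1 : ∀ x ∈ Ω, 1 ≤ β x)
    (hθ : IsBddExponent Ω θ) (ε₀ : ℝ) (hε₀ : 0 < ε₀)
    (hθγβ : ∀ᵐ x ∂((volume : Measure (Eucl n)).restrict Ω), γ x + β x + ε₀ ≤ θ x) :
    ∃ Φ : FunOn Ω → FunOn Ω,
      (∀ u : FunOn Ω, ∀ᵐ x ∂((volume : Measure (Eucl n)).restrict Ω),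
        Φ u x = |u x| ^ (γ x / β x) * u x) ∧
      Set.BijOn Φ (S1Theta Ω γ β θ)
        (L1Var Ω β ∩ LVar Ω (fun x => θ x * β x / (γ x + β x))) := by
  obtain ⟨γ', Cγ, hγd, hγ'c, hγC, hγ'C⟩ := hγ.exists_bound hΩb
  obtain ⟨β', Cβ, hβd, hβ'c, hβC, hβ'C⟩ := hβ.exists_bound hΩb
  obtain ⟨hθm, Θ, hθΘ⟩ := hθ
  set C := max 1 (max Cγ Cβ)
  have hC1 : 1 ≤ C := le_max_left _ _
  have hCγ : Cγ ≤ C := (le_max_left _ _).trans (le_max_right _ _)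
  have hCβ : Cβ ≤ C := (le_max_right _ _).trans (le_max_right _ _)
  have hΩae : ∀ᵐ x ∂((volume : Measure (Eucl n)).restrict Ω), x ∈ Ω :=
    ae_restrict_mem hΩ.measurableSet
  have hγm : AEMeasurable γ ((volume : Measure (Eucl n)).restrict Ω) :=
    ContinuousOn.aemeasurable (fun x hx => (hγd x hx).continuousAt.continuousWithinAt)
      hΩ.measurableSet
  have hβm : AEMeasurable β ((volume : Measure (Eucl n)).restrict Ω) :=
    ContinuousOn.aemeasurable (fun x hx => (hβd x hx).continuousAt.continuousWithinAt)
      hΩ.measurableSet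
  have hmeas : ∀ {p : Eucl n → ℝ}, AEMeasurable p ((volume : Measure (Eucl n)).restrict Ω) →
      ∀ u : FunOn Ω, AEStronglyMeasurable (fun x => |u x| ^ p x * u x)
        ((volume : Measure (Eucl n)).restrict Ω) := fun hp u =>
    have hu := u.aestronglyMeasurable.aemeasurable
    ((hu.abs.pow hp).mul hu).aestronglyMeasurable
  -- The two factors are (γ+β)/β and β/(γ+β). This single identity yields injectivity and, read in
  -- the other order, surjectivity.
  have hinv : ∀ x ∈ Ω, (γ x / β x + 1) * (-γ x / (γ x + β x) + 1) = 1 := fun x hx => by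
    have h1 := hγ1 x hx
    have h2 := hβ1 x hx
    have h3 : β x ≠ 0 := by linarith
    have h4 : γ x + β x ≠ 0 := by linarith
    field_simp
    ring
  refine ⟨fun u => AEEqFun.mk _ (hmeas (hγm.div hβm) u),
    fun u => AEEqFun.coeFn_mk _ (hmeas (hγm.div hβm) u), fun u hu => ?_, fun u _ w _ huw => ?_,
    fun v hv => ?_⟩
  · exact mem_L1Var_inter_LVar hΩ hΩb hC1 hγd hγ'c (fun x hx => (hγC x hx).trans hCγ)
      (fun x hx => (hγ'C x hx).trans hCγ) hβd hβ'c (fun x hx => (hβC x hx).trans hCβ)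
      (fun x hx => (hβ'C x hx).trans hCβ) hγ1 hβ1 hθm hθΘ hε₀ hθγβ hu
      (AEEqFun.coeFn_mk _ (hmeas (hγm.div hβm) u))
  · refine AEEqFun.ext ?_
    filter_upwards [AEEqFun.mk_eq_mk.1 huw, hΩae] with x hx hxΩ
    have h1 := abs_rpow_mul_self_inverse (hinv x hxΩ) (u x)
    have h2 := abs_rpow_mul_self_inverse (hinv x hxΩ) (w x)
    simp only [Pi.div_apply] at hx
    rw [← h1, ← h2, hx]
  · have hb : AEMeasurable (fun x => -γ x / (γ x + β x))
        ((volume : Measure (Eucl n)).restrict Ω) := hγm.neg.div (hγm.add hβm)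
    have hmk := AEEqFun.coeFn_mk _ (hmeas hb v)
    refine ⟨AEEqFun.mk _ (hmeas hb v), ?_, ?_⟩
    · exact mem_S1Theta hΩ hΩb hC1 hγd hγ'c (fun x hx => (hγC x hx).trans hCγ)
        (fun x hx => (hγ'C x hx).trans hCγ) hβd hβ'c (fun x hx => (hβC x hx).trans hCβ)
        (fun x hx => (hβ'C x hx).trans hCβ) hγ1 hβ1 hθm hθΘ hε₀ hθγβ hv hmk
    · refine AEEqFun.ext ((AEEqFun.coeFn_mk _ _).trans ?_)
      filter_upwards [hmk, hΩae] with x hx hxΩ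
      rw [hx]
      exact abs_rpow_mul_self_inverse ((mul_comm _ _).trans (hinv x hxΩ)) (v x)
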